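/- Let $h\ge 1$, $t\ge 2$ be integers such that $s=ht+1$ is a prime power, let $F$ be the field of order $s$ and $F^*=F\setminus\{0\}$. Let $C_0$ be the subgroup of $F^*$ of order $t$, and index its cosets as $C_i$, $i\in I_h=\mathbb Z/h$, so that $C_iC_j=C_{i+j}$. Choose $p_i\in C_i$ for each $i\in I_h$. Consider the following setting: the units are the pairs $(a,b)\in F^*\times F$, there are $h$ block factors indexed by $I_h$, each with level set $F$, and the $i$th block factor has level $ap_i+b$ on the unit $(a,b)$. A design in this setting is a surjective map $d$ from the units to the set $V=F\times I_h$ of treatments; put $v=|V|=hs$. For a design $d$ let $X_V$ be the unit-by-treatment $0,1$ matrix of $d$, let $X_i$ be the unit-by-level $0,1$ matrix of the $i$th block factor, let $N_i=X_V'X_i$ and $H=\sum_{i\in I_h}N_i$, and let $C_d=X_V'(I-P)X_V$, where $P$ is the orthogonal projection onto the span of the all-ones vector and the columns of all the $X_i$. The design $d$ is connected if $\operatorname{rank} C_d=v-1$, equireplicate if every treatment occurs on the same number of units, and totally binary if all entries of $H$ are $0$ or $1$. Let $\mu_0(C_d)\le\dots\le\mu_{v-1}(C_d)$ be the eigenvalues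 of $C_d$, with multiplicity. Let $d_1^*$ be the design that assigns to the unit $(a,b)$ the treatment $(b,i)$, where $a\in C_i$. Then: 1. the setting is of type 1: there are $s(s-1)$ units, each block factor has $s$ levels, and $X_i'X_j=J_s-I_s$ for all $i\ne j$, where $J_s$ is the all-ones matrix; 2. $d_1^*$ is connected, equireplicate and totally binary; 3. $d_1^*$ is M-optimal in the class of all equireplicate and totally binary designs in this setting: for every such design $d$, $$\sum_{i=0}^{k}\mu_i(C_{d_1^*})\ \ge\ \sum_{i=0}^{k}\mu_i(C_d),\qquad k=0,1,\dots,v-1 .$$ -/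

import Mathlib

namespace MultiwayDesign

section General

variable {U B L V : Type*}

/-- A multi-way experimental set up: the units `U`, the block factors `B`, and the level of each
block factor on each unit. All block factors share the level set `L`, and every level of every
block factor occurs. -/
structure Setting (U B L : Type*) where
  level : U → B → L
  level_surjective : ∀ A : B, Function.Surjective fun u => level u A

/-- A design in the set up `σ` with treatment set `V`: an allocation of treatments to the units in
which every treatment occurs. -/
structure Design (σ : Setting U B L) (V : Type*) where
  treatment : U → V
  treatment_surjective : Function.Surjective treatment

/-- The design matrix of a factor: the `(u, p)` entry is `1` if the factor is at level `p` on the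
unit `u`, and `0` otherwise. -/
def designMatrix {S : Type*} [DecidableEq S] (f : U → S) : Matrix U S ℝ :=
  Matrix.of fun u p => if f u = p then 1 else 0

/-- The matrix of the orthogonal projection onto the column space of `M`. -/
noncomputable def colProj {m n : Type*} [Fintype m] [DecidableEq m] [Fintype n] [DecidableEq n]
    (M : Matrix m n ℝ) : Matrix m m ℝ :=
  Matrix.toEuclideanLin.symm
    ((LinearMap.range (Matrix.toEuclideanLin M)).starProjection :
      EuclideanSpace ℝ m →ₗ[ℝ] EuclideanSpace ℝ m)

theorem colProj_isHermitian {m n : Type*} [Fintype m] [DecidableEq m] [Fintype n] [DecidableEq n]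
    (M : Matrix m n ℝ) : (colProj M).IsHermitian := by
  rw [← Matrix.isSymmetric_toEuclideanLin_iff, colProj, LinearEquiv.apply_symm_apply]
  exact Submodule.starProjection_isSymmetric _

namespace Setting

/-- The design matrix `X_A` of the block factor `A`. -/
def blockMatrix [DecidableEq L] (σ : Setting U B L) (A : B) : Matrix U L ℝ :=
  designMatrix fun u => σ.level u A

/-- The incidence matrix `M_{AA'} = X_A' X_{A'}` of two block factors. -/
def incidence [Fintype U] [DecidableEq L] (σ : Setting U B L) (A A' : B) : Matrix L L ℝ :=
  (σ.blockMatrix A).transpose * σ.blockMatrix A'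

/-- The design matrix of all factors other than the treatment factor: the column of ones of the
general effect, followed by the columns of the matrices `X_A` of all block factors `A`. -/
def nuisanceMatrix [DecidableEq L] (σ : Setting U B L) : Matrix U (Unit ⊕ B × L) ℝ :=
  Matrix.fromCols (Matrix.of fun _ _ => 1) (Matrix.of fun u Al => σ.blockMatrix Al.1 u Al.2)

/-- A setting of type 1: with `s` the number of levels of each block factor, there are `s(s-1)`
units and `M_{AA'} = J_s - I_s` for any two distinct block factors. -/
def IsTypeOne [Fintype U] [Fintype L] [DecidableEq L] (σ : Setting U B L) : Prop :=
  Fintype.card U = Fintype.card L * (Fintype.card L - 1) ∧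
    ∀ A A' : B, A ≠ A' → σ.incidence A A' = (Matrix.of fun _ _ => 1) - 1

end Setting

/-- The eigenvalues of a real symmetric matrix, with multiplicity, in nondecreasing order. -/
noncomputable def ascEigenvalues {n : Type*} [Fintype n] [DecidableEq n] {A : Matrix n n ℝ}
    (hA : A.IsHermitian) : Fin (Fintype.card n) → ℝ :=
  fun i => hA.eigenvalues₀ i.rev

/-- For nondecreasing vectors, `x` is weakly majorized from above by `y`: every partial sum of the
smallest entries of `x` is at least the corresponding partial sum for `y`. -/
def WeaklyMajorizedFromAbove {n : ℕ} (x y : Fin n → ℝ) : Prop :=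
  ∀ k : Fin n, ∑ i ∈ Finset.Iic k, y i ≤ ∑ i ∈ Finset.Iic k, x i

namespace Design

variable {σ : Setting U B L}

/-- The design matrix `X_V` of the treatment factor. -/
def treatmentMatrix [DecidableEq V] (d : Design σ V) : Matrix U V ℝ :=
  designMatrix d.treatment

/-- The treatment versus `A` incidence matrix `N_A = X_V' X_A`. -/
def incidence [Fintype U] [DecidableEq L] [DecidableEq V] (d : Design σ V) (A : B) :
    Matrix V L ℝ :=
  d.treatmentMatrix.transpose * σ.blockMatrix A

/-- `H = ∑_A N_A`, the sum being over all block factors. -/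
def totalIncidence [Fintype U] [Fintype B] [DecidableEq L] [DecidableEq V] (d : Design σ V) :
    Matrix V L ℝ :=
  ∑ A : B, d.incidence A

/-- Every treatment occurs on the same number of units. -/
def Equireplicate [Fintype U] [DecidableEq V] (d : Design σ V) : Prop :=
  ∃ r : ℕ, ∀ p : V, (Finset.univ.filter fun u => d.treatment u = p).card = r

/-- All entries of `H` are `0` or `1`. -/
def TotallyBinary [Fintype U] [Fintype B] [DecidableEq L] [DecidableEq V] (d : Design σ V) :
    Prop :=
  ∀ p l, d.totalIncidence p l = 0 ∨ d.totalIncidence p l = 1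

section CMatrix

variable [Fintype U] [DecidableEq U] [Fintype B] [DecidableEq B] [Fintype L] [DecidableEq L]
  [DecidableEq V]

/-- The C-matrix `X_V' (I - P) X_V`, where `P` is the projection onto the column space of the
design matrix of all factors other than the treatment factor. -/
noncomputable def cMatrix (d : Design σ V) : Matrix V V ℝ :=
  d.treatmentMatrix.transpose * (1 - colProj σ.nuisanceMatrix) * d.treatmentMatrix

theorem cMatrix_isHermitian (d : Design σ V) : d.cMatrix.IsHermitian := by
  have h := Matrix.isHermitian_conjTranspose_mul_mul d.treatmentMatrix
    (Matrix.isHermitian_one.sub (colProj_isHermitian σ.nuisanceMatrix))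
  rwa [Matrix.conjTranspose_eq_transpose_of_trivial] at h

/-- The design is connected: its C-matrix has rank `v - 1`. -/
def Connected [Fintype V] (d : Design σ V) : Prop :=
  d.cMatrix.rank + 1 = Fintype.card V

/-- `d` is M-better than `d'`: the eigenvalue vector of `C_d` is weakly majorized from above by
that of `C_{d'}`. -/
def MBetter [Fintype V] (d d' : Design σ V) : Prop :=
  WeaklyMajorizedFromAbove (ascEigenvalues d.cMatrix_isHermitian)
    (ascEigenvalues d'.cMatrix_isHermitian)

/-- `d` is M-optimal in the class `D`: it belongs to `D` and is M-better than every member. -/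
def MOptimal [Fintype V] (D : Set (Design σ V)) (d : Design σ V) : Prop :=
  d ∈ D ∧ ∀ d' ∈ D, d.MBetter d'

end CMatrix

/-- The class of all equireplicate and totally binary designs in a set up. -/
def equireplicateTotallyBinary [Fintype U] [Fintype B] [DecidableEq L] [DecidableEq V]
    (σ : Setting U B L) : Set (Design σ V) :=
  {d | d.Equireplicate ∧ d.TotallyBinary}

end Design

end General

section DOne

variable {F : Type*} [Field F] {h : ℕ}

/-- The set up of `d₁*`: the units are the pairs `(a, b)` with `a ∈ F*` and `b ∈ F`, the block
factors are indexed by the integers modulo `h`, and factor `i` has level `a p_i + b` on the unit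
`(a, b)`. -/
def settingOne (p : ZMod h → Fˣ) : Setting (Fˣ × F) (ZMod h) F where
  level u i := (u.1 : F) * (p i : F) + u.2
  level_surjective i x := ⟨(1, x - p i), by simp⟩

/-- The design `d₁*`, with treatment set `F × ℤ/h`: the unit `(a, b)` receives the treatment
`(b, i)` with `a ∈ C_i`. The indexing `i ↦ C_i` of the cosets of `C₀` in `F*`, with
`C_i C_j = C_{i+j}`, is the isomorphism `C`. -/
def dOne {C₀ : Subgroup Fˣ} (C : Multiplicative (ZMod h) ≃* Fˣ ⧸ C₀) (p : ZMod h → Fˣ) :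
    Design (settingOne p) (F × ZMod h) where
  treatment u := (u.2, (C.symm (u.1 : Fˣ ⧸ C₀)).toAdd)
  treatment_surjective := by
    rintro ⟨x, i⟩
    obtain ⟨a, ha⟩ := QuotientGroup.mk_surjective (C (Multiplicative.ofAdd i))
    exact ⟨(a, x), by simp [ha]⟩

end DOne

end MultiwayDesign

namespace MultiwayDesign

open Matrix

set_option linter.unusedSectionVars false

/-! Write `s = |F|`, let `Q` be the centering matrix of the levels and `S = ∑ X_A`. The incidences
`J - I` make the nuisance projection split as `P₀ + P₁ + P₂`: the constants, the vectors `S f` with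
`f` centered, and the `∑ X_A f_A` with all `f_A` centered and `∑ f_A = 0`, of ranks `1`, `s - 1`,
`(s - 1)(h - 1)`. So an equireplicate design has `C_d = t - (D₀ + D₁ + D₂)` with `D_i = X_V' P_i
X_V` positive semidefinite and of rank at most that of `P_i`. Total binarity fixes the traces of the
`D_i` (`IsUniform.colProj_nuisanceMatrix`, `trace_component_sumProj`,
`trace_component_contrastProj`).

For `d₁*` the count of `l` with `(l - x)/(l - y)` in a given coset shows that the `D_i` are the
multiples `t`, `1/(s - h)`, `1` of the mutually orthogonal projections `J/s ⊗ J/h`, `Q ⊗ J/h`, `Q ⊗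
Q_h`. Its spectrum is `0`, `t - 1`, `t - 1/(s - h)`, `t`.

This spectrum is extremal for the given ranks and traces. Ky Fan's inequality, tested on the ranges
of `D₀`, `D₀ + D₂`, `D₀ + D₁ + D₂`, bounds the partial sums of an arbitrary competitor at the three
corners, and averaging test matrices interpolates linearly in between. For `d₁*` a dual certificate
shows that the bounds are reached (`weaklyMajorizedFromAbove_of_decomposition`). -/

theorem rank_add_le {m n : Type*} [Fintype m] [Fintype n] (S T : Matrix m n ℝ) :
    (S + T).rank ≤ S.rank + T.rank := by
  unfold Matrix.rank
  rw [Matrix.mulVecLin_add]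
  refine le_trans (Submodule.finrank_mono ?_) (Submodule.finrank_add_le_finrank_add_finrank _ _)
  exact LinearMap.range_add_le _ _

/-! ### Ky Fan bounds and a majorization criterion. -/

section KyFan

variable {n : Type*} [Fintype n] [DecidableEq n] {A : Matrix n n ℝ}

/-- The diagonal entries of `T` in an orthonormal eigenbasis of `A`, the basis vectors being ordered
by increasing eigenvalue. -/
noncomputable def eigenDiag (hA : A.IsHermitian) (T : Matrix n n ℝ)
    (i : Fin (Fintype.card n)) : ℝ :=
  ((star (hA.eigenvectorUnitary : Matrix n n ℝ)) * T * (hA.eigenvectorUnitary : Matrix n n ℝ))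
    (Fintype.equivOfCardEq (Fintype.card_fin _) i.rev)
    (Fintype.equivOfCardEq (Fintype.card_fin _) i.rev)

theorem ascEigenvalues_monotone (hA : A.IsHermitian) : Monotone (ascEigenvalues hA) :=
  fun _ _ hij => hA.eigenvalues₀_antitone (Fin.rev_le_rev.2 hij)

theorem eigenvectorUnitary_mul_star (hA : A.IsHermitian) :
    (hA.eigenvectorUnitary : Matrix n n ℝ) * star (hA.eigenvectorUnitary : Matrix n n ℝ) = 1 :=
  Unitary.coe_mul_star_self _

theorem star_mul_mul_eigenvectorUnitary (hA : A.IsHermitian) :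
    star (hA.eigenvectorUnitary : Matrix n n ℝ) * A * (hA.eigenvectorUnitary : Matrix n n ℝ) =
      diagonal hA.eigenvalues := by
  have h := hA.conjStarAlgAut_star_eigenvectorUnitary
  rw [Unitary.conjStarAlgAut_star_apply] at h
  exact h

theorem sum_eigenDiag_eq_trace (hA : A.IsHermitian) (T : Matrix n n ℝ) :
    ∑ i, eigenDiag hA T i = T.trace := by
  have h : (star (hA.eigenvectorUnitary : Matrix n n ℝ) * T *
      (hA.eigenvectorUnitary : Matrix n n ℝ)).trace = T.trace := by
    rw [Matrix.trace_mul_comm, ← Matrix.mul_assoc, eigenvectorUnitary_mul_star, Matrix.one_mul]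
  rw [← h, Matrix.trace]
  exact Equiv.sum_comp (Fin.revPerm.trans (Fintype.equivOfCardEq (Fintype.card_fin _)))
    fun j => (star (hA.eigenvectorUnitary : Matrix n n ℝ) * T *
      (hA.eigenvectorUnitary : Matrix n n ℝ)) j j

/-- `T` need not commute with `A`: the right factor becomes diagonal, so it only scales the columns
of the conjugated `T`. -/
theorem eigenDiag_mul_self (hA : A.IsHermitian) (T : Matrix n n ℝ) (i : Fin (Fintype.card n)) :
    eigenDiag hA (T * A) i = eigenDiag hA T i * ascEigenvalues hA i := by
  have h : star (hA.eigenvectorUnitary : Matrix n n ℝ) * (T * A) *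
        (hA.eigenvectorUnitary : Matrix n n ℝ) =
      (star (hA.eigenvectorUnitary : Matrix n n ℝ) * T * (hA.eigenvectorUnitary : Matrix n n ℝ)) *
        diagonal hA.eigenvalues := by
    rw [← star_mul_mul_eigenvectorUnitary hA]
    simp only [Matrix.mul_assoc]
    rw [← Matrix.mul_assoc (hA.eigenvectorUnitary : Matrix n n ℝ), eigenvectorUnitary_mul_star,
      Matrix.one_mul]
  rw [eigenDiag, h, Matrix.mul_diagonal, eigenDiag]
  simp [ascEigenvalues, IsHermitian.eigenvalues]

theorem eigenDiag_one (hA : A.IsHermitian) (i : Fin (Fintype.card n)) : eigenDiag hA 1 i = 1 := by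
  simp [eigenDiag]

theorem eigenDiag_self (hA : A.IsHermitian) (i : Fin (Fintype.card n)) :
    eigenDiag hA A i = ascEigenvalues hA i := by
  simpa [eigenDiag_one] using eigenDiag_mul_self hA 1 i

theorem eigenDiag_add (hA : A.IsHermitian) (S T : Matrix n n ℝ) (i : Fin (Fintype.card n)) :
    eigenDiag hA (S + T) i = eigenDiag hA S i + eigenDiag hA T i := by
  simp [eigenDiag, Matrix.mul_add, Matrix.add_mul]

theorem eigenDiag_smul (hA : A.IsHermitian) (c : ℝ) (T : Matrix n n ℝ)
    (i : Fin (Fintype.card n)) : eigenDiag hA (c • T) i = c * eigenDiag hA T i := by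
  simp [eigenDiag]

theorem eigenDiag_sub (hA : A.IsHermitian) (S T : Matrix n n ℝ) (i : Fin (Fintype.card n)) :
    eigenDiag hA (S - T) i = eigenDiag hA S i - eigenDiag hA T i := by
  simp [eigenDiag, Matrix.mul_sub, Matrix.sub_mul]

theorem eigenDiag_nonneg (hA : A.IsHermitian) {T : Matrix n n ℝ} (hT : T.PosSemidef)
    (i : Fin (Fintype.card n)) : 0 ≤ eigenDiag hA T i :=
  (hT.conjTranspose_mul_mul_same (hA.eigenvectorUnitary : Matrix n n ℝ)).diag_nonneg

/-- Ky Fan's upper bound for sums of smallest eigenvalues, with an effect `0 ≤ T ≤ 1` in place of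
a projection. -/
theorem sum_ascEigenvalues_le (hA : A.IsHermitian) {c : ℝ} (hc : (c • 1 - A).PosSemidef)
    {T : Matrix n n ℝ} (hT : T.PosSemidef) (hT' : (1 - T).PosSemidef)
    (k : Fin (Fintype.card n)) (htr : T.trace ≤ k + 1) :
    ∑ i ∈ Finset.Iic k, ascEigenvalues hA i ≤ (k + 1) * c - (T * (c • 1 - A)).trace := by
  set μ := ascEigenvalues hA
  set w := eigenDiag hA T
  have hw0 : ∀ i, 0 ≤ w i := eigenDiag_nonneg hA hT
  have hw1 : ∀ i, w i ≤ 1 := fun i => by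
    have := eigenDiag_nonneg hA hT' i
    rw [eigenDiag_sub, eigenDiag_one] at this
    linarith
  have hμ : ∀ i, μ i ≤ c := fun i => by
    have := eigenDiag_nonneg hA hc i
    rw [eigenDiag_sub, eigenDiag_smul, eigenDiag_one, eigenDiag_self] at this
    change 0 ≤ c * 1 - μ i at this
    linarith
  have htrw : ∑ i, w i ≤ k + 1 := (sum_eigenDiag_eq_trace hA T).trans_le htr
  have hprod : (T * (c • 1 - A)).trace = ∑ i, w i * (c - μ i) := by
    rw [← sum_eigenDiag_eq_trace hA]
    refine Finset.sum_congr rfl fun i _ => ?_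
    rw [Matrix.mul_sub, eigenDiag_sub, eigenDiag_mul_self, Matrix.mul_smul, Matrix.mul_one,
      eigenDiag_smul]
    ring
  have hcard : ∑ _i ∈ Finset.Iic k, (1 : ℝ) = k + 1 := by simp [Fin.card_Iic]
  -- `μ k - μ i` is nonnegative up to `k` and nonpositive after it, so among weights in `[0, 1]` the
  -- indicator of `Iic k` maximizes the sum.
  have hkey : ∑ i, w i * (μ k - μ i) ≤ ∑ i ∈ Finset.Iic k, (μ k - μ i) := by
    rw [← Finset.sum_filter_add_sum_filter_not Finset.univ (· ∈ Finset.Iic k)]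
    have h1 : ∑ i with i ∈ Finset.Iic k, w i * (μ k - μ i) ≤ ∑ i ∈ Finset.Iic k, (μ k - μ i) := by
      rw [Finset.filter_mem_eq_inter, Finset.univ_inter]
      refine Finset.sum_le_sum fun i hi => ?_
      have : μ i ≤ μ k := ascEigenvalues_monotone hA (Finset.mem_Iic.1 hi)
      nlinarith [hw1 i]
    have h2 : ∑ i with i ∉ Finset.Iic k, w i * (μ k - μ i) ≤ 0 := by
      refine Finset.sum_nonpos fun i hi => ?_
      have hi' : k < i := by simpa using hi
      have : μ k ≤ μ i := ascEigenvalues_monotone hA hi'.le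
      nlinarith [hw0 i]
    linarith
  have e1 : ∑ i, w i * (c - μ i) = ∑ i, w i * (μ k - μ i) + (∑ i, w i) * (c - μ k) := by
    rw [Finset.sum_mul, ← Finset.sum_add_distrib]
    exact Finset.sum_congr rfl fun i _ => by ring
  have e2 : ∑ i ∈ Finset.Iic k, (μ k - μ i) = (k + 1) * μ k - ∑ i ∈ Finset.Iic k, μ i := by
    rw [Finset.sum_sub_distrib, ← hcard, Finset.sum_mul]
    simp
  -- Since `μ k ≤ c`, an upper bound on the trace of `T` suffices; no equality is needed.
  have h3 : (∑ i, w i) * (c - μ k) ≤ (k + 1) * (c - μ k) :=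
    mul_le_mul_of_nonneg_right htrw (by linarith [hμ k])
  rw [hprod, e1]
  linarith

/-- A lower bound for sums of smallest eigenvalues, dual to Ky Fan's. -/
theorem le_sum_ascEigenvalues (hA : A.IsHermitian) {c : ℝ} {W : Matrix n n ℝ} (hW : W.PosSemidef)
    (h : (A + W - c • 1).PosSemidef) (k : Fin (Fintype.card n)) :
    (k + 1) * c - W.trace ≤ ∑ i ∈ Finset.Iic k, ascEigenvalues hA i := by
  have hcard : ∑ _i ∈ Finset.Iic k, (1 : ℝ) = k + 1 := by simp [Fin.card_Iic]
  have h1 : ∑ i ∈ Finset.Iic k, eigenDiag hA W i ≤ W.trace := by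
    rw [← sum_eigenDiag_eq_trace hA]
    exact Finset.sum_le_sum_of_subset_of_nonneg (Finset.subset_univ _)
      fun i _ _ => eigenDiag_nonneg hA hW i
  have h2 : ∑ i ∈ Finset.Iic k, (c - eigenDiag hA W i) ≤
      ∑ i ∈ Finset.Iic k, ascEigenvalues hA i := by
    refine Finset.sum_le_sum fun i _ => ?_
    have := eigenDiag_nonneg hA h i
    rw [eigenDiag_sub, eigenDiag_add, eigenDiag_smul, eigenDiag_one, eigenDiag_self] at this
    linarith
  rw [Finset.sum_sub_distrib] at h2
  have h3 : ∑ _i ∈ Finset.Iic k, c = (k + 1) * c := by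
    rw [← hcard, Finset.sum_mul]; simp
  linarith

/-- The projection onto the range of a symmetric matrix. -/
theorem exists_rangeProj (hA : A.IsHermitian) :
    ∃ T : Matrix n n ℝ, T.PosSemidef ∧ (1 - T).PosSemidef ∧ T.trace = A.rank ∧ T * A = A := by
  set U := (hA.eigenvectorUnitary : Matrix n n ℝ)
  have hU : star U * U = 1 := Unitary.coe_star_mul_self _
  have hU' : U * star U = 1 := Unitary.coe_mul_star_self _
  have hAU : A = U * diagonal hA.eigenvalues * star U := by
    rw [← star_mul_mul_eigenvectorUnitary hA]
    change A = U * (star U * A * U) * star U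
    rw [← Matrix.mul_assoc, ← Matrix.mul_assoc, hU', Matrix.mul_assoc, hU']; simp
  set e : n → ℝ := fun i => if hA.eigenvalues i = 0 then 0 else 1
  refine ⟨U * diagonal e * star U, ?_, ?_, ?_, ?_⟩
  · refine (PosSemidef.diagonal fun i => ?_).mul_mul_conjTranspose_same U
    simp only [e]; split_ifs <;> simp
  · have : (1 : Matrix n n ℝ) - U * diagonal e * star U = U * diagonal (1 - e) * star U := by
      rw [← hU', ← Matrix.sub_mul]
      congr 1
      conv_lhs => rw [← Matrix.mul_one U, Matrix.mul_assoc, ← Matrix.mul_sub, Matrix.one_mul]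
      rw [← diagonal_one, diagonal_sub]; rfl
    rw [this]
    refine (PosSemidef.diagonal fun i => ?_).mul_mul_conjTranspose_same U
    simp only [e, Pi.sub_apply]; split_ifs <;> simp
  · rw [Matrix.trace_mul_comm, ← Matrix.mul_assoc, hU, Matrix.one_mul, trace_diagonal,
      hA.rank_eq_card_non_zero_eigs, Fintype.card_subtype]
    simp only [e]
    rw [Finset.card_filter]
    push_cast
    exact Finset.sum_congr rfl fun i _ => by by_cases h : hA.eigenvalues i = 0 <;> simp [h]
  · have hd : diagonal e * diagonal hA.eigenvalues = diagonal hA.eigenvalues := by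
      rw [diagonal_mul_diagonal]
      congr 1; ext i; simp only [e]; split_ifs with h <;> simp [h]
    calc U * diagonal e * star U * A
        = U * diagonal e * (star U * U) * diagonal hA.eigenvalues * star U := by
          conv_lhs => rw [hAU]
          simp only [Matrix.mul_assoc]
      _ = A := by
          rw [hU, Matrix.mul_one, Matrix.mul_assoc U, hd, ← hAU]

theorem trace_mul_nonneg {S T : Matrix n n ℝ} (hS : S.PosSemidef) (hT : T.PosSemidef) :
    0 ≤ (S * T).trace := by
  rw [← sum_eigenDiag_eq_trace hT.isHermitian]
  refine Finset.sum_nonneg fun i _ => ?_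
  rw [eigenDiag_mul_self]
  refine mul_nonneg (eigenDiag_nonneg _ hS i) ?_
  rw [← eigenDiag_self]
  exact eigenDiag_nonneg _ hT i

/-- An effect `0 ≤ T ≤ 1` of trace at most the rank of `D` which captures the trace of `D`. -/
theorem exists_effect {D R : Matrix n n ℝ} (hD : D.PosSemidef) (hR : R.PosSemidef) {m : ℕ}
    (hm : D.rank ≤ m) :
    ∃ T : Matrix n n ℝ, T.PosSemidef ∧ (1 - T).PosSemidef ∧ T.trace ≤ m ∧
      D.trace ≤ (T * (D + R)).trace := by
  obtain ⟨T, h0, h1, h2, h3⟩ := exists_rangeProj hD.isHermitian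
  refine ⟨T, h0, h1, ?_, ?_⟩
  · rw [h2]; exact_mod_cast hm
  · rw [Matrix.mul_add, Matrix.trace_add, h3]
    linarith [trace_mul_nonneg h0 hR]

/-- Averaging the bounds of `sum_ascEigenvalues_le` for two effects. -/
theorem sum_ascEigenvalues_le_of_two (hA : A.IsHermitian) {c : ℝ} (hc : (c • 1 - A).PosSemidef)
    {S T : Matrix n n ℝ} (hS : S.PosSemidef) (hS' : (1 - S).PosSemidef)
    (hT : T.PosSemidef) (hT' : (1 - T).PosSemidef) {a b x y θ : ℝ} (h0 : 0 ≤ θ) (h1 : θ ≤ 1)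
    (hSa : S.trace ≤ a) (hTb : T.trace ≤ b) (hSx : x ≤ (S * (c • 1 - A)).trace)
    (hTy : y ≤ (T * (c • 1 - A)).trace) (k : Fin (Fintype.card n))
    (htr : (1 - θ) * a + θ * b ≤ k + 1) :
    ∑ i ∈ Finset.Iic k, ascEigenvalues hA i ≤ (k + 1) * c - ((1 - θ) * x + θ * y) := by
  have h1' : 0 ≤ 1 - θ := by linarith
  refine (sum_ascEigenvalues_le hA hc (T := (1 - θ) • S + θ • T)
    ((hS.smul h1').add (hT.smul h0)) ?_ k ?_).trans ?_
  · have : (1 : Matrix n n ℝ) - ((1 - θ) • S + θ • T) = (1 - θ) • (1 - S) + θ • (1 - T) := by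
      module
    rw [this]
    exact (hS'.smul h1').add (hT'.smul h0)
  · rw [Matrix.trace_add, Matrix.trace_smul, Matrix.trace_smul, smul_eq_mul, smul_eq_mul]
    nlinarith
  · rw [Matrix.add_mul, Matrix.smul_mul, Matrix.smul_mul, Matrix.trace_add, Matrix.trace_smul,
      Matrix.trace_smul, smul_eq_mul, smul_eq_mul]
    nlinarith

/-- A majorization criterion: the spectrum `0, c - 1, c - ε, c` with multiplicities
`1, m₂, m₁` (and the rest) is extremal among the matrices `c - (D₀ + D₁ + D₂)` with prescribed
traces and ranks of the summands. -/
theorem weaklyMajorizedFromAbove_of_decomposition {A' : Matrix n n ℝ} (hA : A.IsHermitian)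
    (hA' : A'.IsHermitian) {c ε : ℝ} (hc : 1 ≤ c) (hε0 : 0 ≤ ε) (hε1 : ε ≤ 1) {m₁ m₂ : ℕ}
    {D₀ D₁ D₂ : Matrix n n ℝ} (hD : A = c • 1 - (D₀ + D₁ + D₂))
    (hD₀ : D₀.PosSemidef) (hD₁ : D₁.PosSemidef) (hD₂ : D₂.PosSemidef)
    (hr₀ : D₀.rank ≤ 1) (hr₁ : D₁.rank ≤ m₁) (hr₂ : D₂.rank ≤ m₂)
    (ht₀ : D₀.trace = c) (ht₁ : D₁.trace = ε * m₁) (ht₂ : D₂.trace = m₂)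
    {E₀ E₁ E₂ : Matrix n n ℝ} (hE : A' = c • 1 - (c • E₀ + ε • E₁ + E₂))
    (hE₀ : E₀.PosSemidef) (hE₁ : E₁.PosSemidef) (hE₂ : E₂.PosSemidef)
    (hE₃ : (1 - (E₀ + E₁ + E₂)).PosSemidef)
    (hs₀ : E₀.trace = 1) (hs₁ : E₁.trace = m₁) (hs₂ : E₂.trace = m₂) :
    WeaklyMajorizedFromAbove (ascEigenvalues hA') (ascEigenvalues hA) := by
  intro k
  have hB : c • 1 - A = D₀ + D₁ + D₂ := by rw [hD]; abel
  have hB0 : (c • 1 - A).PosSemidef := hB ▸ (hD₀.add hD₁).add hD₂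
  -- Test matrices for the three corners `1`, `1 + m₂`, `1 + m₁ + m₂`. `D₂` comes before `D₁`
  -- because its weight per dimension, `1`, is at least `ε`.
  obtain ⟨S, hS, hS', hSt, hSx⟩ := exists_effect hD₀ (hD₁.add hD₂) hr₀
  obtain ⟨T, hT, hT', hTt, hTx⟩ := exists_effect (hD₀.add hD₂) hD₁
    ((rank_add_le _ _).trans (add_le_add hr₀ hr₂))
  obtain ⟨R, hR, hR', hRt, hRx⟩ := exists_effect ((hD₀.add hD₁).add hD₂) (PosSemidef.zero)
    ((rank_add_le _ _).trans (add_le_add ((rank_add_le _ _).trans (add_le_add hr₀ hr₁)) hr₂))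
  rw [← add_assoc, ← hB, ht₀] at hSx
  rw [add_right_comm, ← hB, Matrix.trace_add, ht₀, ht₂] at hTx
  rw [add_zero, ← hB, hB, Matrix.trace_add, Matrix.trace_add, ht₀, ht₁, ht₂, ← hB] at hRx
  push_cast at hSt hTt hRt
  rcases le_total ((k : ℝ) + 1) (1 + m₂) with hk | hk
  -- In each range the certificate `W` lifts the eigenvalues of `A'` below the current level exactly
  -- to that level: here `0` to `c - 1`.
  · refine le_trans ?_ (le_sum_ascEigenvalues hA' (c := c - 1) (W := (c - 1) • E₀)
      (hE₀.smul (by linarith)) ?_ k)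
    · have hk0 : (0 : ℝ) ≤ k := Nat.cast_nonneg _
      have hkm : (k : ℝ) ≤ m₂ := by linarith
      -- `θ` is the position of `k + 1` between the corners `1` and `1 + m₂`; if `m₂ = 0` then `k =
      -- 0`.
      obtain ⟨θ, hθ0, hθ1, hθ⟩ : ∃ θ : ℝ, 0 ≤ θ ∧ θ ≤ 1 ∧ θ * m₂ = k := by
        rcases eq_or_lt_of_le (Nat.cast_nonneg m₂ : (0 : ℝ) ≤ m₂) with h | h
        · exact ⟨0, le_rfl, zero_le_one, by linarith⟩
        · exact ⟨k / m₂, by positivity, (div_le_one h).2 hkm, div_mul_cancel₀ _ h.ne'⟩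
      refine (sum_ascEigenvalues_le_of_two hA hB0 hS hS' hT hT' hθ0 hθ1 hSt hTt hSx hTx k
        (by linarith)).trans ?_
      rw [Matrix.trace_smul, hs₀, smul_eq_mul]
      linarith
    · have : A' + (c - 1) • E₀ - (c - 1) • 1 = (1 - (E₀ + E₁ + E₂)) + (1 - ε) • E₁ := by
        rw [hE]; module
      rw [this]
      exact hE₃.add (hE₁.smul (by linarith))
  rcases le_total ((k : ℝ) + 1) (1 + m₁ + m₂) with hk' | hk'
  · refine le_trans ?_ (le_sum_ascEigenvalues hA' (c := c - ε)
      (W := (c - ε) • E₀ + (1 - ε) • E₂)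
      ((hE₀.smul (by linarith)).add (hE₂.smul (by linarith))) ?_ k)
    · obtain ⟨θ, hθ0, hθ1, hθ⟩ : ∃ θ : ℝ, 0 ≤ θ ∧ θ ≤ 1 ∧ θ * m₁ = k - m₂ := by
        rcases eq_or_lt_of_le (Nat.cast_nonneg m₁ : (0 : ℝ) ≤ m₁) with h | h
        · exact ⟨0, le_rfl, zero_le_one, by linarith⟩
        · exact ⟨(k - m₂) / m₁, div_nonneg (by linarith) h.le, (div_le_one h).2 (by linarith),
            div_mul_cancel₀ _ h.ne'⟩
      refine (sum_ascEigenvalues_le_of_two hA hB0 hT hT' hR hR' hθ0 hθ1 hTt hRt hTx hRx k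
        (by linarith)).trans ?_
      rw [Matrix.trace_add, Matrix.trace_smul, Matrix.trace_smul, hs₀, hs₂, smul_eq_mul,
        smul_eq_mul]
      have : θ * (ε * m₁) = ε * (k - m₂) := by rw [← hθ]; ring
      linarith
    · have : A' + ((c - ε) • E₀ + (1 - ε) • E₂) - (c - ε) • 1 = ε • (1 - (E₀ + E₁ + E₂)) := by
        rw [hE]; module
      rw [this]
      exact hE₃.smul hε0
  · refine le_trans ?_ (le_sum_ascEigenvalues hA' (c := c) (W := c • E₀ + ε • E₁ + E₂)
      (((hE₀.smul (by linarith)).add (hE₁.smul hε0)).add hE₂) ?_ k)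
    · refine (sum_ascEigenvalues_le hA hB0 hR hR' k (by linarith)).trans ?_
      rw [Matrix.trace_add, Matrix.trace_add, Matrix.trace_smul, Matrix.trace_smul, hs₀, hs₁, hs₂,
        smul_eq_mul, smul_eq_mul]
      linarith
    · have : A' + (c • E₀ + ε • E₁ + E₂) - c • 1 = 0 := by
        rw [hE]; module
      rw [this]
      exact PosSemidef.zero

end KyFan

/-! ### The all-ones and centering matrices. -/

section Centering

/-- The all-ones matrix. -/
def allOnes (m n : Type*) : Matrix m n ℝ := Matrix.of fun _ _ => 1

/-- The centering matrix `1 - J / s`. -/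
noncomputable def centering (L : Type*) [Fintype L] [DecidableEq L] : Matrix L L ℝ :=
  1 - (Fintype.card L : ℝ)⁻¹ • allOnes L L

theorem allOnes_transpose (m n : Type*) : (allOnes m n)ᵀ = allOnes n m := rfl

theorem allOnes_mul_allOnes (m L n : Type*) [Fintype L] :
    allOnes m L * allOnes L n = (Fintype.card L : ℝ) • allOnes m n := by
  ext i j; simp [allOnes, Matrix.mul_apply]

variable {L m : Type*} [Fintype L] [DecidableEq L]

theorem centering_transpose : (centering L)ᵀ = centering L := by
  simp [centering, allOnes_transpose]

theorem centering_apply (x y : L) :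
    centering L x y = (if x = y then 1 else 0) - (Fintype.card L : ℝ)⁻¹ := by
  simp [centering, Matrix.one_apply, allOnes]

theorem centering_mul_allOnes [Nonempty L] : centering L * allOnes L m = 0 := by
  have : (Fintype.card L : ℝ) ≠ 0 := by exact_mod_cast Fintype.card_ne_zero
  rw [centering, Matrix.sub_mul, Matrix.one_mul, Matrix.smul_mul, allOnes_mul_allOnes, smul_smul,
    inv_mul_cancel₀ this, one_smul, sub_self]

theorem centering_mul_centering [Nonempty L] : centering L * centering L = centering L := by
  conv_lhs => enter [2]; rw [centering]
  rw [Matrix.mul_sub, Matrix.mul_one, Matrix.mul_smul, centering_mul_allOnes, smul_zero, sub_zero]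

theorem trace_centering [Nonempty L] : (centering L).trace = Fintype.card L - 1 := by
  have : (Fintype.card L : ℝ) ≠ 0 := by exact_mod_cast Fintype.card_ne_zero
  simp [Matrix.trace, centering_apply, this]

end Centering

/-! ### Idempotent matrices and orthogonal projections. -/

section Projections

theorem posSemidef_of_isIdempotentElem {m : Type*} [Fintype m] {P : Matrix m m ℝ}
    (hP : P * P = P) (hs : Pᵀ = P) :
    P.PosSemidef := by
  have h := posSemidef_conjTranspose_mul_self P
  rwa [conjTranspose_eq_transpose_of_trivial, hs, hP] at h

variable {m n : Type*} [Fintype m] [DecidableEq m] [Fintype n] [DecidableEq n]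

theorem rank_eq_trace_of_isIdempotentElem {P : Matrix m m ℝ} (hP : P * P = P) :
    (P.rank : ℝ) = P.trace := by
  have h : IsIdempotentElem (Matrix.toLin' P) := by
    rw [IsIdempotentElem, Module.End.mul_eq_comp, ← Matrix.toLin'_mul, hP]
  rw [← Matrix.trace_toLin'_eq, (LinearMap.IsIdempotentElem.isProj_range _ h).trace, Matrix.rank,
    Matrix.toLin'_apply']

/-- A matrix which fixes the columns of `M` and kills their orthogonal complement is the orthogonal
projection onto the column space of `M`. -/
theorem colProj_eq {M : Matrix m n ℝ} {P : Matrix m m ℝ} (hfix : P * M = M)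
    (hker : ∀ z, Mᵀ *ᵥ z = 0 → P *ᵥ z = 0) : colProj M = P := by
  rw [colProj, LinearEquiv.symm_apply_eq]
  refine LinearMap.ext fun x => ?_
  set K := LinearMap.range (Matrix.toEuclideanLin M)
  change K.starProjection x = Matrix.toEuclideanLin P x
  have hy : K.starProjection x ∈ K := Submodule.starProjection_apply_mem _ _
  have hz : x - K.starProjection x ∈ Kᗮ := Submodule.sub_starProjection_mem_orthogonal x
  set y := K.starProjection x
  obtain ⟨a, ha⟩ := hy
  have hPy : Matrix.toEuclideanLin P y = y := by
    rw [← ha]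
    simp [Matrix.toLpLin_apply, Matrix.mulVec_mulVec, hfix]
  have hPz : Matrix.toEuclideanLin P (x - y) = 0 := by
    rw [Matrix.toLpLin_apply, hker, WithLp.toLp_zero]
    ext j
    have h := (Submodule.mem_orthogonal _ _).1 hz _
      (LinearMap.mem_range_self (Matrix.toEuclideanLin M) (EuclideanSpace.single j 1))
    simpa [Matrix.toLpLin_apply, EuclideanSpace.inner_eq_star_dotProduct, Matrix.mulVec,
      dotProduct_comm, Matrix.col] using! h
  rw [map_sub, hPy, sub_eq_zero] at hPz
  exact hPz.symm

end Projections

/-! ### The nuisance space of a uniform setting. -/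

namespace Setting

variable {U B L : Type*} [Fintype U] [Fintype B] [Fintype L] [DecidableEq L]

/-- The sum of the design matrices of all block factors. -/
def blockSum (σ : Setting U B L) : Matrix U L ℝ := ∑ A, σ.blockMatrix A

/-- The projection onto the constant vectors. -/
noncomputable def meanProj (_σ : Setting U B L) : Matrix U U ℝ :=
  (Fintype.card U : ℝ)⁻¹ • allOnes U U

/-- `∑ X_A Q X_A'`, with `Q` the centering matrix. -/
noncomputable def withinSum (σ : Setting U B L) : Matrix U U ℝ :=
  ∑ A, σ.blockMatrix A * centering L * (σ.blockMatrix A)ᵀ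

/-- `S Q S'`, with `S` the sum of the `X_A` and `Q` the centering matrix. -/
noncomputable def betweenSum (σ : Setting U B L) : Matrix U U ℝ :=
  σ.blockSum * centering L * σ.blockSumᵀ

/-- The projection onto the centered vectors in the column space of `∑ X_A`. -/
noncomputable def sumProj (σ : Setting U B L) : Matrix U U ℝ :=
  ((Fintype.card B : ℝ) * (Fintype.card L - Fintype.card B))⁻¹ • σ.betweenSum

/-- The projection onto the vectors `∑ X_A f_A` with all `f_A` centered and `∑ f_A = 0`. -/
noncomputable def contrastProj (σ : Setting U B L) : Matrix U U ℝ :=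
  (Fintype.card L : ℝ)⁻¹ • (σ.withinSum - (Fintype.card B : ℝ)⁻¹ • σ.betweenSum)

variable {σ : Setting U B L}

theorem blockMatrix_mul_allOnes {m : Type*} (A : B) :
    σ.blockMatrix A * allOnes L m = allOnes U m := by
  ext u j
  simp [blockMatrix, designMatrix, allOnes, Matrix.mul_apply]

theorem meanProj_transpose : σ.meanProjᵀ = σ.meanProj := by
  simp [meanProj, allOnes_transpose]

theorem withinSum_transpose : σ.withinSumᵀ = σ.withinSum := by
  simp [withinSum, Matrix.transpose_sum, Matrix.transpose_mul, centering_transpose,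
    Matrix.mul_assoc]

theorem betweenSum_transpose : σ.betweenSumᵀ = σ.betweenSum := by
  simp [betweenSum, Matrix.transpose_mul, centering_transpose, Matrix.mul_assoc]

theorem sumProj_transpose : σ.sumProjᵀ = σ.sumProj := by
  simp [sumProj, betweenSum_transpose]

theorem contrastProj_transpose : σ.contrastProjᵀ = σ.contrastProj := by
  simp [contrastProj, betweenSum_transpose, withinSum_transpose]

theorem meanProj_mul_meanProj [Nonempty U] : σ.meanProj * σ.meanProj = σ.meanProj := by
  have : (Fintype.card U : ℝ) ≠ 0 := by exact_mod_cast Fintype.card_ne_zero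
  simp [meanProj, allOnes_mul_allOnes, smul_smul, this]

theorem trace_meanProj [Nonempty U] : σ.meanProj.trace = 1 := by
  have : (Fintype.card U : ℝ) ≠ 0 := by exact_mod_cast Fintype.card_ne_zero
  simp [meanProj, allOnes, Matrix.trace, this]

/-- Type 1 incidences, including those of each factor with itself. -/
def IsUniform (σ : Setting U B L) : Prop :=
  (∀ A A', A ≠ A' → σ.incidence A A' = allOnes L L - 1) ∧
    ∀ A, σ.incidence A A = ((Fintype.card L : ℝ) - 1) • 1

section Uniform

variable [DecidableEq B] [Nonempty L]

/-- `Q` annihilates `J`, so every incidence matrix acts as a scalar behind `Q`. All products and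
traces of `withinSum` and `betweenSum` follow from this. -/
theorem IsUniform.centering_mul_incidence (hσ : σ.IsUniform) (A A' : B) :
    centering L * ((σ.blockMatrix A)ᵀ * σ.blockMatrix A') =
      ((if A = A' then (Fintype.card L : ℝ) else 0) - 1) • centering L := by
  change centering L * σ.incidence A A' = _
  split_ifs with h
  · subst h; rw [hσ.2]; simp
  · rw [hσ.1 A A' h, Matrix.mul_sub, centering_mul_allOnes]; simp

theorem IsUniform.centering_mul_blockSum (hσ : σ.IsUniform) (A : B) :
    centering L * ((σ.blockSum)ᵀ * σ.blockMatrix A) =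
      ((Fintype.card L : ℝ) - Fintype.card B) • centering L := by
  rw [blockSum, Matrix.transpose_sum, Matrix.sum_mul, Matrix.mul_sum]
  simp_rw [hσ.centering_mul_incidence, ← Finset.sum_smul]
  simp

theorem IsUniform.withinSum_mul_blockMatrix (hσ : σ.IsUniform) (A : B) :
    σ.withinSum * σ.blockMatrix A =
      (Fintype.card L : ℝ) • (σ.blockMatrix A * centering L) - σ.blockSum * centering L := by
  rw [withinSum, Matrix.sum_mul]
  simp_rw [Matrix.mul_assoc, hσ.centering_mul_incidence, sub_smul, Matrix.mul_sub, one_smul]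
  rw [Finset.sum_sub_distrib, blockSum, Matrix.sum_mul]
  congr 1
  rw [Finset.sum_eq_single A (fun A' _ h => by simp [h]) (by simp)]
  simp

theorem IsUniform.betweenSum_mul_blockMatrix (hσ : σ.IsUniform) (A : B) :
    σ.betweenSum * σ.blockMatrix A =
      ((Fintype.card L : ℝ) - Fintype.card B) • (σ.blockSum * centering L) := by
  rw [betweenSum, Matrix.mul_assoc, Matrix.mul_assoc, hσ.centering_mul_blockSum, Matrix.mul_smul]

theorem IsUniform.withinSum_mul_withinSum (hσ : σ.IsUniform) :
    σ.withinSum * σ.withinSum = (Fintype.card L : ℝ) • σ.withinSum - σ.betweenSum := by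
  conv_lhs => enter [2]; rw [withinSum]
  rw [Matrix.mul_sum]
  simp_rw [← Matrix.mul_assoc, hσ.withinSum_mul_blockMatrix, Matrix.sub_mul, Matrix.smul_mul,
    Matrix.mul_assoc _ (centering L) (centering L), centering_mul_centering]
  rw [Finset.sum_sub_distrib, ← Finset.smul_sum, ← Matrix.mul_sum, ← Matrix.transpose_sum]
  rfl

theorem IsUniform.betweenSum_mul_withinSum (hσ : σ.IsUniform) :
    σ.betweenSum * σ.withinSum = ((Fintype.card L : ℝ) - Fintype.card B) • σ.betweenSum := by
  conv_lhs => enter [2]; rw [withinSum]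
  rw [Matrix.mul_sum]
  simp_rw [← Matrix.mul_assoc, hσ.betweenSum_mul_blockMatrix, Matrix.smul_mul,
    Matrix.mul_assoc _ (centering L) (centering L), centering_mul_centering]
  rw [← Finset.smul_sum, ← Matrix.mul_sum, ← Matrix.transpose_sum]
  rfl

theorem IsUniform.withinSum_mul_betweenSum (hσ : σ.IsUniform) :
    σ.withinSum * σ.betweenSum = ((Fintype.card L : ℝ) - Fintype.card B) • σ.betweenSum := by
  have h := congrArg Matrix.transpose hσ.betweenSum_mul_withinSum
  rwa [Matrix.transpose_mul, Matrix.transpose_smul, withinSum_transpose,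
    betweenSum_transpose] at h

theorem IsUniform.betweenSum_mul_betweenSum (hσ : σ.IsUniform) :
    σ.betweenSum * σ.betweenSum =
      ((Fintype.card B : ℝ) * (Fintype.card L - Fintype.card B)) • σ.betweenSum := by
  have h : σ.betweenSum * σ.blockSum =
      ((Fintype.card B : ℝ) * (Fintype.card L - Fintype.card B)) •
        (σ.blockSum * centering L) := by
    conv_lhs => enter [2]; rw [blockSum]
    rw [Matrix.mul_sum]
    simp_rw [hσ.betweenSum_mul_blockMatrix]
    rw [Finset.sum_const, Finset.card_univ, ← Nat.cast_smul_eq_nsmul ℝ, smul_smul]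
  conv_lhs => enter [2]; rw [betweenSum]
  rw [← Matrix.mul_assoc, ← Matrix.mul_assoc, h, Matrix.smul_mul, Matrix.smul_mul,
    Matrix.mul_assoc σ.blockSum, centering_mul_centering]
  rfl

variable [Nonempty B]

theorem IsUniform.sumProj_mul_sumProj (hσ : σ.IsUniform) (hBL : Fintype.card B < Fintype.card L) :
    σ.sumProj * σ.sumProj = σ.sumProj := by
  have h1 : (Fintype.card B : ℝ) ≠ 0 := by exact_mod_cast Fintype.card_ne_zero
  have h2 : (Fintype.card L : ℝ) - Fintype.card B ≠ 0 := by
    rw [sub_ne_zero]; exact_mod_cast hBL.ne'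
  rw [sumProj, Matrix.smul_mul, Matrix.mul_smul, hσ.betweenSum_mul_betweenSum,
    inv_smul_smul₀ (mul_ne_zero h1 h2)]

/-- With `W = withinSum`, `G = betweenSum` and `b` block factors, this is a consequence of `W² = s W
- G`, `W G = G W = (s - b) G` and `G² = b (s - b) G`. -/
theorem IsUniform.contrastProj_mul_contrastProj (hσ : σ.IsUniform) :
    σ.contrastProj * σ.contrastProj = σ.contrastProj := by
  have h1 : (Fintype.card B : ℝ) ≠ 0 := by exact_mod_cast Fintype.card_ne_zero
  have h2 : (Fintype.card L : ℝ) ≠ 0 := by exact_mod_cast Fintype.card_ne_zero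
  rw [contrastProj, Matrix.smul_mul, Matrix.mul_smul, Matrix.sub_mul, Matrix.mul_sub,
    Matrix.mul_sub, Matrix.smul_mul, Matrix.smul_mul, Matrix.mul_smul, Matrix.mul_smul,
    hσ.withinSum_mul_withinSum, hσ.withinSum_mul_betweenSum, hσ.betweenSum_mul_withinSum,
    hσ.betweenSum_mul_betweenSum]
  match_scalars
  · field_simp
  · field_simp
    ring

theorem IsUniform.trace_betweenSum (hσ : σ.IsUniform) :
    σ.betweenSum.trace =
      (Fintype.card B : ℝ) * (Fintype.card L - Fintype.card B) * (Fintype.card L - 1) := by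
  rw [betweenSum, Matrix.trace_mul_comm, ← Matrix.mul_assoc, Matrix.trace_mul_comm]
  conv_lhs => enter [1, 2, 2]; rw [blockSum]
  simp_rw [Matrix.mul_sum, hσ.centering_mul_blockSum]
  rw [Matrix.trace_sum]
  simp [trace_centering]
  ring

theorem IsUniform.trace_withinSum (hσ : σ.IsUniform) :
    σ.withinSum.trace = (Fintype.card B : ℝ) * ((Fintype.card L : ℝ) - 1) ^ 2 := by
  rw [withinSum, Matrix.trace_sum]
  have : ∀ A, (σ.blockMatrix A * centering L * (σ.blockMatrix A)ᵀ).trace =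
      ((Fintype.card L : ℝ) - 1) ^ 2 := fun A => by
    rw [Matrix.trace_mul_comm, ← Matrix.mul_assoc, Matrix.trace_mul_comm,
      hσ.centering_mul_incidence, if_pos rfl, Matrix.trace_smul, trace_centering, smul_eq_mul, sq]
  simp [this]

theorem IsUniform.trace_sumProj (hσ : σ.IsUniform) (hBL : Fintype.card B < Fintype.card L) :
    σ.sumProj.trace = Fintype.card L - 1 := by
  have h1 : (Fintype.card B : ℝ) ≠ 0 := by exact_mod_cast Fintype.card_ne_zero
  have h2 : (Fintype.card L : ℝ) - Fintype.card B ≠ 0 := by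
    rw [sub_ne_zero]; exact_mod_cast hBL.ne'
  rw [sumProj, Matrix.trace_smul, hσ.trace_betweenSum, smul_eq_mul]
  field_simp

theorem IsUniform.trace_contrastProj (hσ : σ.IsUniform) :
    σ.contrastProj.trace = ((Fintype.card L : ℝ) - 1) * (Fintype.card B - 1) := by
  have h1 : (Fintype.card B : ℝ) ≠ 0 := by exact_mod_cast Fintype.card_ne_zero
  have h2 : (Fintype.card L : ℝ) ≠ 0 := by exact_mod_cast Fintype.card_ne_zero
  rw [contrastProj, Matrix.trace_smul, Matrix.trace_sub, Matrix.trace_smul, hσ.trace_betweenSum,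
    hσ.trace_withinSum, smul_eq_mul, smul_eq_mul]
  field_simp
  ring

/-- Split `X_A = X_A Q + J/s`. With `b` block factors, the mean part gives `J/s`, the sum part `S Q
/ b`, and the contrast part `X_A Q - S Q / b`. -/
theorem IsUniform.proj_mul_blockMatrix (hσ : σ.IsUniform)
    (hBL : Fintype.card B < Fintype.card L)
    (hU : Fintype.card U = Fintype.card L * (Fintype.card L - 1)) (A : B) :
    (σ.meanProj + σ.sumProj + σ.contrastProj) * σ.blockMatrix A = σ.blockMatrix A := by
  have hL : 1 < Fintype.card L := lt_of_le_of_lt (Nat.one_le_iff_ne_zero.2 Fintype.card_ne_zero) hBL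
  have h1 : (Fintype.card B : ℝ) ≠ 0 := by exact_mod_cast Fintype.card_ne_zero
  have h2 : (Fintype.card L : ℝ) - Fintype.card B ≠ 0 := by
    rw [sub_ne_zero]; exact_mod_cast hBL.ne'
  have h3 : (Fintype.card L : ℝ) ≠ 0 := by exact_mod_cast Fintype.card_ne_zero
  have h4 : (Fintype.card L : ℝ) - 1 ≠ 0 := by
    rw [sub_ne_zero]; exact_mod_cast hL.ne'
  have hU' : (Fintype.card U : ℝ) = Fintype.card L * (Fintype.card L - 1) := by
    rw [hU, Nat.cast_mul, Nat.cast_sub hL.le, Nat.cast_one]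
  have hJ : allOnes U U * σ.blockMatrix A = ((Fintype.card L : ℝ) - 1) • allOnes U L := by
    rw [← allOnes_transpose, ← blockMatrix_mul_allOnes (σ := σ) A, Matrix.transpose_mul,
      Matrix.mul_assoc]
    have h : (σ.blockMatrix A)ᵀ * σ.blockMatrix A = _ := hσ.2 A
    rw [h, allOnes_transpose]; simp
  rw [Matrix.add_mul, Matrix.add_mul, meanProj, sumProj, contrastProj, Matrix.smul_mul,
    Matrix.smul_mul, Matrix.smul_mul, Matrix.sub_mul, Matrix.smul_mul, hJ,
    hσ.betweenSum_mul_blockMatrix, hσ.withinSum_mul_blockMatrix, hU']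
  have hX : σ.blockMatrix A = σ.blockMatrix A * centering L +
      (Fintype.card L : ℝ)⁻¹ • allOnes U L := by
    rw [centering, Matrix.mul_sub, Matrix.mul_smul, blockMatrix_mul_allOnes]; simp
  conv_rhs => rw [hX]
  match_scalars <;> field_simp
  ring

/-- The projection onto the nuisance space is the sum of three explicit projections. -/
theorem IsUniform.colProj_nuisanceMatrix [DecidableEq U] (hσ : σ.IsUniform)
    (hBL : Fintype.card B < Fintype.card L)
    (hU : Fintype.card U = Fintype.card L * (Fintype.card L - 1)) :
    colProj σ.nuisanceMatrix = σ.meanProj + σ.sumProj + σ.contrastProj := by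
  have hX := hσ.proj_mul_blockMatrix hBL hU
  refine colProj_eq ?_ fun z hz => ?_
  · rw [nuisanceMatrix, Matrix.mul_fromCols]
    congr 1
    · change _ * allOnes U Unit = allOnes U Unit
      obtain ⟨A⟩ := ‹Nonempty B›
      rw [← blockMatrix_mul_allOnes (σ := σ) A, ← Matrix.mul_assoc, hX]
    · ext u ⟨A, l⟩
      exact congrFun₂ (hX A) u l
  · have h0 : allOnes U U *ᵥ z = 0 := by
      ext u
      simpa [nuisanceMatrix, Matrix.mulVec, dotProduct, allOnes] using congrFun hz (Sum.inl ())
    have h1 : ∀ A, (σ.blockMatrix A)ᵀ *ᵥ z = 0 := fun A => by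
      ext l
      simpa [nuisanceMatrix, Matrix.mulVec, dotProduct] using congrFun hz (Sum.inr (A, l))
    have h2 : σ.blockSumᵀ *ᵥ z = 0 := by
      rw [blockSum, Matrix.transpose_sum, Matrix.sum_mulVec]; simp [h1]
    -- Every term of the three matrices ends in `J`, `X_A'` or `S'`, and each of these kills `z`.
    simp [meanProj, sumProj, contrastProj, withinSum, betweenSum, Matrix.add_mulVec,
      Matrix.sub_mulVec, Matrix.smul_mulVec, Matrix.sum_mulVec, ← Matrix.mulVec_mulVec, h0, h1, h2]

end Uniform

end Setting

/-! ### C-matrices of equireplicate designs, and the effect of total binarity. -/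

namespace Design

variable {U B L V : Type*} [Fintype U] [Fintype B] [Fintype L] [DecidableEq L] [Fintype V]
  [DecidableEq V] {σ : Setting U B L}

/-- The part of `X_V' P X_V` due to a symmetric projection `P`. -/
def component (d : Design σ V) (P : Matrix U U ℝ) : Matrix V V ℝ :=
  d.treatmentMatrixᵀ * P * d.treatmentMatrix

theorem component_posSemidef (d : Design σ V) {P : Matrix U U ℝ} (hP : P * P = P) (hs : Pᵀ = P) :
    (d.component P).PosSemidef := by
  have h := (posSemidef_of_isIdempotentElem hP hs).conjTranspose_mul_mul_same d.treatmentMatrix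
  rwa [conjTranspose_eq_transpose_of_trivial] at h

theorem component_rank_le [DecidableEq U] (d : Design σ V) {P : Matrix U U ℝ} (hP : P * P = P)
    {m : ℕ} (hm : P.trace = m) : (d.component P).rank ≤ m := by
  have h1 : (d.component P).rank ≤ P.rank :=
    (rank_mul_le_left _ _).trans (rank_mul_le_right _ _)
  have h2 : P.rank = m := by
    have := rank_eq_trace_of_isIdempotentElem hP
    rw [hm] at this
    exact_mod_cast this
  exact h1.trans h2.le

theorem incidence_apply (d : Design σ V) (A : B) (p : V) (l : L) :
    d.incidence A p l =
      ((Finset.univ.filter fun u => d.treatment u = p ∧ σ.level u A = l).card : ℝ) := by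
  simp only [incidence, treatmentMatrix, Setting.blockMatrix, designMatrix, Matrix.mul_apply,
    Matrix.transpose_apply, Matrix.of_apply, Finset.card_filter]
  push_cast
  refine Finset.sum_congr rfl fun u _ => ?_
  by_cases h1 : d.treatment u = p <;> by_cases h2 : σ.level u A = l <;> simp [h1, h2]

theorem treatmentMatrix_mul_allOnes {m : Type*} (d : Design σ V) :
    d.treatmentMatrix * allOnes V m = allOnes U m := by
  ext u j
  simp [treatmentMatrix, designMatrix, allOnes, Matrix.mul_apply]

theorem totalIncidence_eq (d : Design σ V) :
    d.totalIncidence = d.treatmentMatrixᵀ * σ.blockSum := by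
  rw [totalIncidence, Setting.blockSum, Matrix.mul_sum]
  rfl

theorem mul_centering_mul_transpose [Nonempty L] {N : Matrix V L ℝ} {c : ℝ}
    (hN : N * allOnes L V = c • allOnes V V) :
    N * centering L * Nᵀ = N * Nᵀ - ((Fintype.card L : ℝ)⁻¹ * c ^ 2) • allOnes V V := by
  -- Factoring `J` through `V` lets the row-sum hypothesis apply; the factor `|V|` must then be
  -- cancelled, hence the separate case of empty `V`.
  have hJ : (Fintype.card V : ℝ) • allOnes L L = allOnes L V * allOnes V L :=
    (allOnes_mul_allOnes L V L).symm
  have h2 : allOnes V L * Nᵀ = c • allOnes V V := by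
    have := congrArg Matrix.transpose hN
    rwa [Matrix.transpose_mul, Matrix.transpose_smul, allOnes_transpose, allOnes_transpose] at this
  rcases isEmpty_or_nonempty V with hV | hV
  · exact Matrix.ext fun i => hV.elim i
  have hv : (Fintype.card V : ℝ) ≠ 0 := by exact_mod_cast Fintype.card_ne_zero
  have h3 : N * allOnes L L * Nᵀ = c ^ 2 • allOnes V V := by
    have : (Fintype.card V : ℝ) • (N * allOnes L L * Nᵀ) =
        (Fintype.card V : ℝ) • (c ^ 2 • allOnes V V) := by
      rw [← Matrix.smul_mul, ← Matrix.mul_smul, hJ, ← Matrix.mul_assoc, hN, Matrix.mul_assoc, h2,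
        Matrix.smul_mul, Matrix.mul_smul, allOnes_mul_allOnes]
      module
    exact smul_right_injective _ hv this
  rw [centering, Matrix.mul_sub, Matrix.sub_mul, Matrix.mul_one, Matrix.mul_smul, Matrix.smul_mul,
    h3, smul_smul]

/-- Entries in `{0, 1}` equal their squares, so the squared norm of a row is its row sum. This is
how binarity fixes the traces. -/
theorem trace_mul_transpose_of_binary {N : Matrix V L ℝ} {c : ℝ}
    (hN : N * allOnes L V = c • allOnes V V) (hb : ∀ p l, N p l = 0 ∨ N p l = 1) :
    (N * Nᵀ).trace = Fintype.card V * c := by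
  have h : ∀ p, (N * Nᵀ) p p = c := fun p => by
    have := congrFun₂ hN p p
    simp only [Matrix.mul_apply, allOnes, Matrix.of_apply, Matrix.smul_apply, mul_one,
      smul_eq_mul] at this
    rw [Matrix.mul_apply, ← this]
    refine Finset.sum_congr rfl fun l _ => ?_
    rcases hb p l with h | h <;> simp [h]
  simp [Matrix.trace, h]

/-- The entries of `N_A` are natural numbers dominated by those of `H`. -/
theorem TotallyBinary.incidence {d : Design σ V} (hd : d.TotallyBinary) (A : B) (p : V) (l : L) :
    d.incidence A p l = 0 ∨ d.incidence A p l = 1 := by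
  have hle : d.incidence A p l ≤ d.totalIncidence p l := by
    rw [totalIncidence, Matrix.sum_apply]
    refine Finset.single_le_sum (f := fun A => d.incidence A p l) (fun A' _ => ?_)
      (Finset.mem_univ A)
    rw [incidence_apply]
    exact Nat.cast_nonneg _
  have h1 : d.totalIncidence p l ≤ 1 := by rcases hd p l with h | h <;> simp [h]
  rw [incidence_apply] at hle ⊢
  have : (Finset.univ.filter fun u => d.treatment u = p ∧ σ.level u A = l).card ≤ 1 := by
    exact_mod_cast hle.trans h1
  rcases Nat.le_one_iff_eq_zero_or_eq_one.1 this with h | h <;> simp [h]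

/-- Every treatment occurs on exactly `t` units. -/
def HasReplication (d : Design σ V) (t : ℕ) : Prop :=
  ∀ p : V, (Finset.univ.filter fun u => d.treatment u = p).card = t

theorem Equireplicate.hasReplication [Nonempty V] {d : Design σ V} (hd : d.Equireplicate) {t : ℕ}
    (hU : Fintype.card U = Fintype.card V * t) : d.HasReplication t := by
  obtain ⟨r, hr⟩ := hd
  have h : Fintype.card U = Fintype.card V * r := by
    rw [← Finset.card_univ, Finset.card_eq_sum_card_fiberwise (f := d.treatment)
      (t := Finset.univ) (fun _ _ => Finset.mem_coe.2 (Finset.mem_univ _))]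
    simp [hr]
  have : r = t := Nat.eq_of_mul_eq_mul_left Fintype.card_pos (h.symm.trans hU)
  exact this ▸ hr

namespace HasReplication

variable {d : Design σ V} {t : ℕ}

theorem transpose_mul_allOnes {m : Type*} (hd : d.HasReplication t) :
    d.treatmentMatrixᵀ * allOnes U m = (t : ℝ) • allOnes V m := by
  ext p j
  simp [treatmentMatrix, designMatrix, allOnes, Matrix.mul_apply, ← hd p]

theorem transpose_mul_self (hd : d.HasReplication t) :
    d.treatmentMatrixᵀ * d.treatmentMatrix = (t : ℝ) • 1 := by
  ext p q
  rw [Matrix.mul_apply]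
  simp only [treatmentMatrix, designMatrix, Matrix.transpose_apply, Matrix.of_apply,
    Matrix.smul_apply, Matrix.one_apply, smul_eq_mul]
  split_ifs with h
  · subst h
    rw [← hd p, Finset.card_filter]
    push_cast
    rw [mul_one]
    exact Finset.sum_congr rfl fun u _ => by split_ifs <;> simp
  · rw [mul_zero]
    refine Finset.sum_eq_zero fun u _ => ?_
    by_cases h1 : d.treatment u = p
    · simp [h1, h]
    · simp [h1]

theorem incidence_mul_allOnes {m : Type*} (hd : d.HasReplication t) (A : B) :
    d.incidence A * allOnes L m = (t : ℝ) • allOnes V m := by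
  rw [Design.incidence, Matrix.mul_assoc, Setting.blockMatrix_mul_allOnes,
    hd.transpose_mul_allOnes]

theorem totalIncidence_mul_allOnes {m : Type*} (hd : d.HasReplication t) :
    d.totalIncidence * allOnes L m = ((Fintype.card B : ℝ) * t) • allOnes V m := by
  rw [totalIncidence, Matrix.sum_mul]
  simp_rw [hd.incidence_mul_allOnes]
  rw [Finset.sum_const, Finset.card_univ, ← Nat.cast_smul_eq_nsmul ℝ, smul_smul]

theorem component_meanProj (hd : d.HasReplication t) (hU : Fintype.card U = Fintype.card V * t)
    (ht : t ≠ 0) :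
    d.component σ.meanProj = (t : ℝ) • ((Fintype.card V : ℝ)⁻¹ • allOnes V V) := by
  have hJ : allOnes U U * d.treatmentMatrix = (t : ℝ) • allOnes U V := by
    have := congrArg Matrix.transpose (hd.transpose_mul_allOnes (m := U))
    rwa [Matrix.transpose_mul, Matrix.transpose_transpose, Matrix.transpose_smul,
      allOnes_transpose, allOnes_transpose] at this
  rw [component, Setting.meanProj, Matrix.mul_smul, Matrix.smul_mul, Matrix.mul_assoc, hJ,
    Matrix.mul_smul, hd.transpose_mul_allOnes, hU, smul_smul, smul_smul, smul_smul]
  congr 1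
  have : (t : ℝ) ≠ 0 := by exact_mod_cast ht
  push_cast
  rw [mul_inv]
  field_simp

variable [Nonempty L]

theorem component_betweenSum (hd : d.HasReplication t) :
    d.component σ.betweenSum = d.totalIncidence * d.totalIncidenceᵀ -
      ((Fintype.card L : ℝ)⁻¹ * (Fintype.card B * t) ^ 2) • allOnes V V := by
  rw [← mul_centering_mul_transpose hd.totalIncidence_mul_allOnes, totalIncidence_eq, component,
    Setting.betweenSum, Matrix.transpose_mul, Matrix.transpose_transpose]
  simp only [Matrix.mul_assoc]

theorem component_withinSum (hd : d.HasReplication t) :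
    d.component σ.withinSum = ∑ A, d.incidence A * (d.incidence A)ᵀ -
      (Fintype.card B * ((Fintype.card L : ℝ)⁻¹ * t ^ 2)) • allOnes V V := by
  have h : ∀ A, d.treatmentMatrixᵀ * (σ.blockMatrix A * centering L * (σ.blockMatrix A)ᵀ) *
      d.treatmentMatrix = d.incidence A * (d.incidence A)ᵀ -
        ((Fintype.card L : ℝ)⁻¹ * t ^ 2) • allOnes V V := fun A => by
    rw [← mul_centering_mul_transpose (hd.incidence_mul_allOnes A), Design.incidence,
      Matrix.transpose_mul, Matrix.transpose_transpose]
    simp only [Matrix.mul_assoc]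
  rw [component, Setting.withinSum, Matrix.mul_sum, Matrix.sum_mul]
  simp_rw [h]
  rw [Finset.sum_sub_distrib, Finset.sum_const, Finset.card_univ, ← Nat.cast_smul_eq_nsmul ℝ,
    smul_smul]

theorem component_sumProj :
    d.component σ.sumProj = ((Fintype.card B : ℝ) * (Fintype.card L - Fintype.card B))⁻¹ •
      d.component σ.betweenSum := by
  simp [component, Setting.sumProj]

theorem component_contrastProj :
    d.component σ.contrastProj = (Fintype.card L : ℝ)⁻¹ •
      (d.component σ.withinSum - (Fintype.card B : ℝ)⁻¹ • d.component σ.betweenSum) := by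
  simp [component, Setting.contrastProj, Matrix.mul_sub, Matrix.sub_mul]

variable [Nonempty B]

/-- With `b` block factors and `v = b s`, the trace is `v b t - v (b t)² / s = b · b t · (s - b t)`,
and `s - b t = 1`. -/
theorem trace_component_betweenSum (hd : d.HasReplication t) (hb : d.TotallyBinary)
    (hL : Fintype.card L = Fintype.card B * t + 1)
    (hV : Fintype.card V = Fintype.card B * Fintype.card L) :
    (d.component σ.betweenSum).trace = (Fintype.card B : ℝ) * (Fintype.card L - 1) := by
  have h1 : (Fintype.card L : ℝ) ≠ 0 := by exact_mod_cast Fintype.card_ne_zero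
  have hs : (Fintype.card L : ℝ) = Fintype.card B * t + 1 := by exact_mod_cast hL
  rw [hd.component_betweenSum, Matrix.trace_sub, Matrix.trace_smul,
    trace_mul_transpose_of_binary hd.totalIncidence_mul_allOnes hb]
  have : (allOnes V V).trace = Fintype.card V := by simp [Matrix.trace, allOnes]
  rw [this, hV, smul_eq_mul]
  push_cast
  field_simp
  rw [hs]
  ring

theorem trace_component_sumProj (hd : d.HasReplication t) (hb : d.TotallyBinary)
    (hL : Fintype.card L = Fintype.card B * t + 1)
    (hV : Fintype.card V = Fintype.card B * Fintype.card L) :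
    (d.component σ.sumProj).trace =
      ((Fintype.card L : ℝ) - Fintype.card B)⁻¹ * (Fintype.card L - 1) := by
  have h1 : (Fintype.card B : ℝ) ≠ 0 := by exact_mod_cast Fintype.card_ne_zero
  rw [component_sumProj, Matrix.trace_smul, hd.trace_component_betweenSum hb hL hV, smul_eq_mul,
    mul_inv]
  field_simp

theorem trace_component_contrastProj (hd : d.HasReplication t) (hb : d.TotallyBinary)
    (hL : Fintype.card L = Fintype.card B * t + 1)
    (hV : Fintype.card V = Fintype.card B * Fintype.card L) :
    (d.component σ.contrastProj).trace =
      ((Fintype.card L : ℝ) - 1) * (Fintype.card B - 1) := by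
  have h1 : (Fintype.card B : ℝ) ≠ 0 := by exact_mod_cast Fintype.card_ne_zero
  have h2 : (Fintype.card L : ℝ) ≠ 0 := by exact_mod_cast Fintype.card_ne_zero
  have hs : (Fintype.card L : ℝ) = Fintype.card B * t + 1 := by exact_mod_cast hL
  have hJ : (allOnes V V).trace = Fintype.card V := by simp [Matrix.trace, allOnes]
  rw [component_contrastProj, Matrix.trace_smul, Matrix.trace_sub, Matrix.trace_smul,
    hd.trace_component_betweenSum hb hL hV, hd.component_withinSum, Matrix.trace_sub,
    Matrix.trace_sum, Matrix.trace_smul, hJ]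
  simp_rw [trace_mul_transpose_of_binary (hd.incidence_mul_allOnes _) (hb.incidence _)]
  rw [Finset.sum_const, Finset.card_univ, ← Nat.cast_smul_eq_nsmul ℝ, hV]
  simp only [smul_eq_mul]
  push_cast
  field_simp
  rw [hs]
  ring

/-- The C-matrix of an equireplicate design in a uniform set up. -/
theorem cMatrix_eq [DecidableEq U] [DecidableEq B] (hd : d.HasReplication t) (hσ : σ.IsUniform)
    (hBL : Fintype.card B < Fintype.card L)
    (hU : Fintype.card U = Fintype.card L * (Fintype.card L - 1)) :
    d.cMatrix = (t : ℝ) • 1 -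
      (d.component σ.meanProj + d.component σ.sumProj + d.component σ.contrastProj) := by
  rw [cMatrix, hσ.colProj_nuisanceMatrix hBL hU, Matrix.mul_sub, Matrix.sub_mul, Matrix.mul_one,
    hd.transpose_mul_self]
  simp only [component, Matrix.mul_add, Matrix.add_mul]

end HasReplication

end Design

/-! ### Cosets of `C₀`. -/

section Cyclotomy

variable {F : Type*} [Field F] {h : ℕ} {C₀ : Subgroup Fˣ}
  (C : Multiplicative (ZMod h) ≃* Fˣ ⧸ C₀)

/-- The index `i` of the coset `C_i` containing a unit. -/
def cosetIndex (a : Fˣ) : ZMod h := (C.symm (a : Fˣ ⧸ C₀)).toAdd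

theorem cosetIndex_mul (a b : Fˣ) : cosetIndex C (a * b) = cosetIndex C a + cosetIndex C b := by
  simp [cosetIndex]

theorem cosetIndex_one : cosetIndex C 1 = 0 := by
  simp [cosetIndex]

theorem cosetIndex_div (a b : Fˣ) : cosetIndex C (a / b) = cosetIndex C a - cosetIndex C b := by
  rw [eq_sub_iff_add_eq, ← cosetIndex_mul, div_mul_cancel]

theorem cosetIndex_eq_iff (a : Fˣ) (i : ZMod h) :
    cosetIndex C a = i ↔ (a : Fˣ ⧸ C₀) = C (Multiplicative.ofAdd i) := by
  rw [cosetIndex, ← MulEquiv.symm_apply_eq, ← Multiplicative.toAdd.injective.eq_iff,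
    toAdd_ofAdd]

variable [Fintype F] [DecidableEq F]

theorem card_cosetIndex_eq (i : ZMod h) :
    (Finset.univ.filter fun a : Fˣ => cosetIndex C a = i).card = Nat.card C₀ := by
  obtain ⟨g, hg⟩ := QuotientGroup.mk_surjective (C (Multiplicative.ofAdd i))
  rw [← Fintype.card_subtype, ← Nat.card_eq_fintype_card]
  refine Nat.card_congr (Equiv.symm ⟨fun c => ⟨g * c, ?_⟩, fun a => ⟨g⁻¹ * a, ?_⟩, ?_, ?_⟩)
  · rw [cosetIndex_eq_iff, ← hg]
    exact (QuotientGroup.mk_mul_of_mem g c.2)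
  · rw [← QuotientGroup.eq, hg, ← (cosetIndex_eq_iff C a i).1 a.2]
  · intro c; simp
  · intro a; simp

end Cyclotomy

/-! ### Incidences and concurrences of `d₁*`. -/

section DOne

variable {F : Type*} [Field F] [Fintype F] [DecidableEq F] {h : ℕ} [NeZero h] {C₀ : Subgroup Fˣ}
  {C : Multiplicative (ZMod h) ≃* Fˣ ⧸ C₀} {p : ZMod h → Fˣ}

/-- Given `a`, the first level determines `b`, leaving the equation `a (p_A - p_A') = l - l'`. For
`A ≠ A'` it has one solution in `F*` if `l ≠ l'` and none otherwise; for `A = A'` it holds for all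
`s - 1` units `a` or for none. -/
theorem settingOne_isUniform (hp : Function.Injective p) : (settingOne p).IsUniform := by
  have key : ∀ A A' : ZMod h, ∀ l l' : F, (settingOne p).incidence A A' l l' =
      ∑ a : Fˣ, if l - a * p A = l' - a * p A' then (1 : ℝ) else 0 := fun A A' l l' => by
    rw [Setting.incidence, Matrix.mul_apply]
    change ∑ u : Fˣ × F, (if (u.1 : F) * p A + u.2 = l then (1 : ℝ) else 0) *
      (if (u.1 : F) * p A' + u.2 = l' then (1 : ℝ) else 0) = _
    rw [Fintype.sum_prod_type]
    refine Finset.sum_congr rfl fun a _ => ?_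
    rw [Finset.sum_eq_single (l - a * p A)]
    · rw [if_pos (by ring), one_mul]
      exact if_congr ⟨fun h => by linear_combination h, fun h => by linear_combination h⟩ rfl rfl
    · intro b _ hb
      rw [if_neg, zero_mul]
      rintro rfl
      exact hb (by ring)
    · simp
  constructor
  · intro A A' hA
    ext l l'
    rw [key]
    have hne : (p A : F) - p A' ≠ 0 := fun h0 => hA (hp (Units.ext (sub_eq_zero.1 h0)))
    simp only [allOnes, Matrix.sub_apply, Matrix.of_apply, Matrix.one_apply]
    split_ifs with hl
    · subst hl
      rw [sub_self]
      refine Finset.sum_eq_zero fun a _ => if_neg fun h0 => ?_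
      have : (a : F) * (p A - p A') = 0 := by linear_combination -h0
      exact (mul_ne_zero a.ne_zero hne) this
    · have hl' : l - l' ≠ 0 := sub_ne_zero.2 hl
      rw [Finset.sum_eq_single (Units.mk0 ((l - l') / (p A - p A')) (div_ne_zero hl' hne))]
      · rw [if_pos, sub_zero]
        simp only [Units.val_mk0]
        field_simp
        ring
      · intro a _ ha
        refine if_neg fun h0 => ha (Units.ext ?_)
        rw [Units.val_mk0, eq_div_iff hne]
        linear_combination -h0
      · simp
  · intro A
    ext l l'
    rw [key]
    by_cases hl : l = l'
    · subst hl
      simp [Fintype.card_units, Nat.cast_sub Fintype.card_pos]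
    · simp [hl]

theorem card_units_prod : Fintype.card (Fˣ × F) = Fintype.card F * (Fintype.card F - 1) := by
  rw [Fintype.card_prod, Fintype.card_units, mul_comm]

theorem dOne_hasReplication : (dOne C p).HasReplication (Nat.card C₀) := by
  rintro ⟨x, i⟩
  rw [← card_cosetIndex_eq C i]
  refine Finset.card_bij' (fun u _ => u.1) (fun a _ => (a, x)) ?_ ?_ ?_ ?_
  · rintro ⟨a, b⟩ hu
    simp only [Finset.mem_filter, Finset.mem_univ, true_and, dOne, Prod.mk.injEq] at hu ⊢
    exact hu.2
  · intro a ha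
    simp only [Finset.mem_filter, Finset.mem_univ, true_and, dOne, Prod.mk.injEq] at ha ⊢
    exact ha
  · rintro ⟨a, b⟩ hu
    simp only [Finset.mem_filter, Finset.mem_univ, true_and, dOne, Prod.mk.injEq] at hu ⊢
    exact hu.1.symm
  · simp

/-- The unit is forced: `b = x` and `a = (l - x)/p_A`. As `p_A ∈ C_A`, the condition `a ∈ C_j`
becomes `l - x ∈ C_{j+A}`. -/
theorem dOne_treatment_level_iff (hp : ∀ i, cosetIndex C (p i) = i) (A j : ZMod h) {x l : F}
    (hl : l - x ≠ 0) (u : Fˣ × F) :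
    ((dOne C p).treatment u = (x, j) ∧ (settingOne p).level u A = l) ↔
      u = (Units.mk0 (l - x) hl / p A, x) ∧ cosetIndex C (Units.mk0 (l - x) hl) = j + A := by
  obtain ⟨a, b⟩ := u
  change (b, cosetIndex C a) = (x, j) ∧ (a : F) * p A + b = l ↔ _
  simp only [Prod.mk.injEq]
  constructor
  · rintro ⟨⟨rfl, rfl⟩, hal⟩
    have ha : Units.mk0 (l - b) hl = a * p A := Units.ext (by simp [← hal])
    refine ⟨⟨?_, rfl⟩, ?_⟩
    · rw [ha, mul_div_cancel_right]
    · rw [ha, cosetIndex_mul, hp]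
  · rintro ⟨⟨rfl, rfl⟩, hc⟩
    refine ⟨⟨rfl, ?_⟩, ?_⟩
    · rw [cosetIndex_div, hc, hp, add_sub_cancel_right]
    · rw [← Units.val_mul, div_mul_cancel, Units.val_mk0, sub_add_cancel]

theorem dOne_incidence_of_ne (hp : ∀ i, cosetIndex C (p i) = i) (A j : ZMod h) {x l : F}
    (hl : l - x ≠ 0) :
    (dOne C p).incidence A (x, j) l =
      if cosetIndex C (Units.mk0 (l - x) hl) = j + A then 1 else 0 := by
  rw [Design.incidence_apply]
  simp_rw [dOne_treatment_level_iff hp A j hl]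
  split_ifs with hc
  · simp [hc, Finset.filter_eq']
  · simp [hc]

theorem dOne_incidence_self (A j : ZMod h) (x : F) :
    (dOne C p).incidence A (x, j) x = 0 := by
  rw [Design.incidence_apply, Nat.cast_eq_zero, Finset.card_eq_zero, Finset.filter_eq_empty_iff]
  rintro ⟨a, b⟩ _
  change ¬((b, cosetIndex C a) = (x, j) ∧ (a : F) * p A + b = x)
  simp only [Prod.mk.injEq]
  rintro ⟨⟨rfl, -⟩, h0⟩
  exact (mul_ne_zero a.ne_zero (p A).ne_zero) (by linear_combination h0)

/-- For `l ≠ x` exactly one `A` satisfies `l - x ∈ C_{j+A}`, so a treatment meets each level other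
than `x` once. -/
theorem dOne_totalIncidence (hp : ∀ i, cosetIndex C (p i) = i) (x l : F) (j : ZMod h) :
    (dOne C p).totalIncidence (x, j) l = 1 - if l = x then 1 else 0 := by
  rw [Design.totalIncidence, Matrix.sum_apply]
  split_ifs with hl
  · subst hl
    simp [dOne_incidence_self]
  · simp_rw [dOne_incidence_of_ne hp _ j (sub_ne_zero.2 hl), ← sub_eq_iff_eq_add']
    simp

theorem dOne_totallyBinary (hp : ∀ i, cosetIndex C (p i) = i) : (dOne C p).TotallyBinary := by
  rintro ⟨x, j⟩ l
  rw [dOne_totalIncidence hp]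
  split_ifs <;> simp

theorem dOne_totalIncidence_mul_transpose (hp : ∀ i, cosetIndex C (p i) = i) (x y : F)
    (j k : ZMod h) :
    ((dOne C p).totalIncidence * (dOne C p).totalIncidenceᵀ) (x, j) (y, k) =
      Fintype.card F - 2 + if x = y then 1 else 0 := by
  simp only [Matrix.mul_apply, Matrix.transpose_apply, dOne_totalIncidence hp, mul_sub, sub_mul,
    Finset.sum_sub_distrib, one_mul, mul_one]
  simp [eq_comm]
  ring

theorem sum_incidence_mul_incidence_of_ne (hp : ∀ i, cosetIndex C (p i) = i) {x y l : F}
    (hx : l - x ≠ 0) (hy : l - y ≠ 0) (j k : ZMod h) :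
    ∑ A, (dOne C p).incidence A (x, j) l * (dOne C p).incidence A (y, k) l =
      if cosetIndex C (Units.mk0 (l - x) hx / Units.mk0 (l - y) hy) = j - k then 1 else 0 := by
  simp_rw [dOne_incidence_of_ne hp _ _ hx, dOne_incidence_of_ne hp _ _ hy, ← sub_eq_iff_eq_add']
  rw [Finset.sum_eq_single (cosetIndex C (Units.mk0 (l - x) hx) - j)]
  · rw [if_pos rfl, one_mul, cosetIndex_div]
    exact if_congr ⟨fun h => by linear_combination -h, fun h => by linear_combination -h⟩ rfl rfl
  · intro A _ hA
    rw [if_neg hA.symm, zero_mul]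
  · simp

theorem card_cosetIndex_eq_ne_one (i : ZMod h) :
    ((Finset.univ.filter fun a : Fˣ => cosetIndex C a = i ∧ a ≠ 1).card : ℝ) =
      Nat.card C₀ - if i = 0 then 1 else 0 := by
  have h1 : (Finset.univ.filter fun a : Fˣ => cosetIndex C a = i ∧ a ≠ 1) =
      (Finset.univ.filter fun a : Fˣ => cosetIndex C a = i).erase 1 := by
    ext a; simp [and_comm]
  rw [h1, ← card_cosetIndex_eq C i]
  split_ifs with hi
  · have : (1 : Fˣ) ∈ Finset.univ.filter fun a : Fˣ => cosetIndex C a = i := by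
      simp [cosetIndex_one, hi]
    rw [Finset.cast_card_erase_of_mem this]
  · rw [Finset.erase_eq_of_notMem, sub_zero]
    simp [cosetIndex_one, eq_comm, hi]

/-- The Möbius map `l ↦ (l - x)/(l - y)` is a bijection from `F \ {x, y}` to `F* \ {1}`; its inverse
`a ↦ (x - a y)/(1 - a)` is the map used here. -/
theorem card_cosetIndex_quotient {x y : F} (hxy : x ≠ y) (i : ZMod h) :
    (Finset.univ.filter fun l : F => ∃ (hx : l - x ≠ 0) (hy : l - y ≠ 0),
      cosetIndex C (Units.mk0 (l - x) hx / Units.mk0 (l - y) hy) = i).card =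
    (Finset.univ.filter fun a : Fˣ => cosetIndex C a = i ∧ a ≠ 1).card := by
  symm
  have hxy' : x - y ≠ 0 := sub_ne_zero.2 hxy
  have key : ∀ a : Fˣ, a ≠ 1 → (1 : F) - a ≠ 0 := fun a ha h0 =>
    ha (Units.ext (by simpa using (sub_eq_zero.1 h0).symm))
  have keyx : ∀ a : Fˣ, a ≠ 1 → (x - a * y) / (1 - a) - x = a * ((x - y) / (1 - a)) :=
    fun a ha => by have := key a ha; field_simp; ring
  have keyy : ∀ a : Fˣ, a ≠ 1 → (x - a * y) / (1 - a) - y = (x - y) / (1 - a) :=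
    fun a ha => by have := key a ha; field_simp; ring
  refine Finset.card_bij (fun a _ => (x - a * y) / (1 - a)) ?_ ?_ ?_
  · intro a ha
    simp only [Finset.mem_filter, Finset.mem_univ, true_and] at ha ⊢
    have h1 := div_ne_zero hxy' (key a ha.2)
    refine ⟨by rw [keyx a ha.2]; exact mul_ne_zero a.ne_zero h1, by rwa [keyy a ha.2], ?_⟩
    refine Eq.trans (congrArg (cosetIndex C) ?_) ha.1
    rw [div_eq_iff_eq_mul]
    ext
    simp [keyx a ha.2, keyy a ha.2]
  · intro a ha b hb hab
    simp only [Finset.mem_filter, Finset.mem_univ, true_and] at ha hb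
    have h1 : (x - y) / (1 - (a : F)) = (x - y) / (1 - b) := by
      rw [← keyy a ha.2, ← keyy b hb.2, hab]
    rw [div_eq_div_iff (key a ha.2) (key b hb.2)] at h1
    exact Units.ext (sub_right_injective (mul_left_cancel₀ hxy' h1).symm)
  · intro l hl
    simp only [Finset.mem_filter, Finset.mem_univ, true_and] at hl
    obtain ⟨hx, hy, hi⟩ := hl
    have hne : Units.mk0 (l - x) hx / Units.mk0 (l - y) hy ≠ 1 := by
      rw [Ne, div_eq_one]
      intro h0
      exact hxy (by simpa using congrArg Units.val h0)
    refine ⟨_, by simpa using ⟨hi, hne⟩, ?_⟩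
    rw [div_eq_iff (key _ hne)]
    simp only [Units.val_div_eq_div_val, Units.val_mk0]
    field_simp
    ring

theorem dOne_sum_incidence_mul_transpose (hp : ∀ i, cosetIndex C (p i) = i) (x y : F)
    (j k : ZMod h) :
    (∑ A, (dOne C p).incidence A * ((dOne C p).incidence A)ᵀ) (x, j) (y, k) =
      if x = y then (if j = k then (Fintype.card F : ℝ) - 1 else 0)
      else Nat.card C₀ - if j = k then 1 else 0 := by
  simp only [Matrix.sum_apply, Matrix.mul_apply, Matrix.transpose_apply]
  rw [Finset.sum_comm]
  split_ifs with hxy hjk hjk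
  · subst hxy hjk
    rw [← Finset.add_sum_erase _ _ (Finset.mem_univ x), Finset.sum_eq_zero
      (fun A _ => by rw [dOne_incidence_self, zero_mul]), zero_add,
      Finset.sum_congr rfl (g := fun _ => (1 : ℝ))]
    · rw [Finset.sum_const, nsmul_one, Finset.cast_card_erase_of_mem (Finset.mem_univ x),
        Finset.card_univ]
    · intro l hl
      have hl' := sub_ne_zero.2 (Finset.ne_of_mem_erase hl)
      rw [sum_incidence_mul_incidence_of_ne hp hl' hl']
      simp [cosetIndex_one]
  · subst hxy
    refine Finset.sum_eq_zero fun l _ => ?_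
    by_cases hl : l = x
    · subst hl; simp [dOne_incidence_self]
    · have hl' := sub_ne_zero.2 hl
      rw [sum_incidence_mul_incidence_of_ne hp hl' hl', if_neg]
      rw [div_self', cosetIndex_one]
      exact fun h0 => hjk (sub_eq_zero.1 h0.symm)
  all_goals
    have hcount := card_cosetIndex_eq_ne_one (C := C) (j - k)
    rw [← card_cosetIndex_quotient (C := C) hxy (j - k), Finset.card_filter] at hcount
    push_cast at hcount
    simp only [sub_eq_zero, hjk, if_true, if_false] at hcount
    rw [← hcount]
    refine Finset.sum_congr rfl fun l _ => ?_
    by_cases hx : l = x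
    · subst hx; simp [dOne_incidence_self]
    by_cases hy : l = y
    · subst hy; simp [dOne_incidence_self]
    have hx' := sub_ne_zero.2 hx
    have hy' := sub_ne_zero.2 hy
    rw [sum_incidence_mul_incidence_of_ne hp hx' hy']
    refine if_congr ?_ rfl rfl
    simp [hx', hy', hjk]

end DOne

/-! ### Spectral decomposition, optimality and connectedness of `d₁*`. -/

section DOne

variable {F : Type*} [Field F] [Fintype F] [DecidableEq F] {h t : ℕ} [NeZero h] {C₀ : Subgroup Fˣ}
  {C : Multiplicative (ZMod h) ≃* Fˣ ⧸ C₀} {p : ZMod h → Fˣ}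

theorem dOne_component_betweenSum (hp : ∀ i, cosetIndex C (p i) = i) (hC₀ : Nat.card C₀ = t)
    (hF : Fintype.card F = h * t + 1) (x y : F) (j k : ZMod h) :
    (dOne C p).component (settingOne p).betweenSum (x, j) (y, k) = centering F x y := by
  have hs : (Fintype.card F : ℝ) = h * t + 1 := by exact_mod_cast hF
  have hs0 : (h * t + 1 : ℝ) ≠ 0 := by positivity
  have hd := hC₀ ▸ dOne_hasReplication (C := C) (p := p)
  rw [hd.component_betweenSum, Matrix.sub_apply, Matrix.smul_apply,
    dOne_totalIncidence_mul_transpose hp, centering_apply, ZMod.card, hs]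
  simp only [allOnes, Matrix.of_apply, smul_eq_mul, mul_one]
  field_simp
  ring

/-- The concurrence counts depend only on whether `x = y` and whether `j = k`, which is why a
Kronecker product `Q ⊗ Q_h` emerges. -/
theorem dOne_component_contrastProj (hp : ∀ i, cosetIndex C (p i) = i) (hC₀ : Nat.card C₀ = t)
    (hF : Fintype.card F = h * t + 1) (x y : F) (j k : ZMod h) :
    (dOne C p).component (settingOne p).contrastProj (x, j) (y, k) =
      centering F x y * centering (ZMod h) j k := by
  have hs : (Fintype.card F : ℝ) = h * t + 1 := by exact_mod_cast hF
  have hs0 : (h * t + 1 : ℝ) ≠ 0 := by positivity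
  have hh : (h : ℝ) ≠ 0 := by exact_mod_cast NeZero.ne h
  have hd := hC₀ ▸ dOne_hasReplication (C := C) (p := p)
  rw [Design.HasReplication.component_contrastProj, hd.component_withinSum, Matrix.smul_apply,
    Matrix.sub_apply, Matrix.sub_apply, Matrix.smul_apply, Matrix.smul_apply,
    dOne_sum_incidence_mul_transpose hp, dOne_component_betweenSum hp hC₀ hF, centering_apply,
    centering_apply, ZMod.card, hs, hC₀]
  simp only [allOnes, Matrix.of_apply, smul_eq_mul, mul_one]
  split_ifs <;> field_simp <;> ring

/-- The eigenprojections of the C-matrix of `d₁*` other than the one for the eigenvalue `t` add up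
to a matrix which is at most `1`. -/
theorem dOne_one_sub_posSemidef (hp : ∀ i, cosetIndex C (p i) = i) (hC₀ : Nat.card C₀ = t)
    (hF : Fintype.card F = h * t + 1) (hlt : h < Fintype.card F) :
    (1 - ((Fintype.card (F × ZMod h) : ℝ)⁻¹ • allOnes (F × ZMod h) (F × ZMod h) +
      ((Fintype.card F : ℝ) - h) • (dOne C p).component (settingOne p).sumProj +
      (dOne C p).component (settingOne p).contrastProj)).PosSemidef := by
  have hs0 : (Fintype.card F : ℝ) ≠ 0 := by exact_mod_cast Fintype.card_ne_zero
  have hh : (h : ℝ) ≠ 0 := by exact_mod_cast NeZero.ne h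
  have hsh : (Fintype.card F : ℝ) - h ≠ 0 := by rw [sub_ne_zero]; exact_mod_cast hlt.ne'
  have hJ : ((Fintype.card F : ℝ)⁻¹ • allOnes F F).PosSemidef := by
    refine posSemidef_of_isIdempotentElem ?_ (by simp [allOnes_transpose])
    simp [allOnes_mul_allOnes, smul_smul, hs0]
  have hQ : (centering (ZMod h)).PosSemidef :=
    posSemidef_of_isIdempotentElem centering_mul_centering centering_transpose
  -- The complement is `J/s ⊗ Q_h`, the projection onto centered functions of the coset index alone;
  -- this is the eigenspace for `t`.
  refine Eq.mpr (congrArg Matrix.PosSemidef ?_) (hJ.kronecker hQ)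
  ext ⟨x, j⟩ ⟨y, k⟩
  simp only [Matrix.sub_apply, Matrix.add_apply, Matrix.smul_apply, Matrix.kroneckerMap_apply,
    Design.HasReplication.component_sumProj, dOne_component_contrastProj hp hC₀ hF,
    dOne_component_betweenSum hp hC₀ hF, centering_apply, Fintype.card_prod, ZMod.card,
    Matrix.one_apply, Prod.mk.injEq, allOnes, Matrix.of_apply, smul_eq_mul, mul_one]
  push_cast
  by_cases hx : x = y <;> by_cases hj : j = k <;> simp only [hx, hj, and_self, and_true,
    and_false, if_true, if_false] <;> field_simp <;> ring

/-- The factor `s - h` is inserted and cancelled so that the middle term reads `ε E₁`, with `ε =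
1/(s - h)` and `E₁ = Q ⊗ J/h` a projection. -/
theorem dOne_cMatrix_eq (hp : ∀ i, cosetIndex C (p i) = i) (hC₀ : Nat.card C₀ = t)
    (hF : Fintype.card F = h * t + 1) (hlt : h < Fintype.card F) (ht : t ≠ 0) :
    (dOne C p).cMatrix = (t : ℝ) • 1 - ((t : ℝ) • ((Fintype.card (F × ZMod h) : ℝ)⁻¹ •
        allOnes (F × ZMod h) (F × ZMod h)) +
      ((Fintype.card F : ℝ) - h)⁻¹ • (((Fintype.card F : ℝ) - h) •
        (dOne C p).component (settingOne p).sumProj) +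
      (dOne C p).component (settingOne p).contrastProj) := by
  have hinj : Function.Injective p := fun i j hij => by rw [← hp i, ← hp j, hij]
  have hd := hC₀ ▸ dOne_hasReplication (C := C) (p := p)
  have hsh : (Fintype.card F : ℝ) - h ≠ 0 := by rw [sub_ne_zero]; exact_mod_cast hlt.ne'
  have hU : Fintype.card (Fˣ × F) = Fintype.card (F × ZMod h) * t := by
    rw [card_units_prod, Fintype.card_prod, ZMod.card, hF, Nat.add_sub_cancel, mul_assoc]
  rw [hd.cMatrix_eq (settingOne_isUniform hinj) (by rwa [ZMod.card]) card_units_prod,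
    hd.component_meanProj hU ht, inv_smul_smul₀ hsh]

theorem posSemidef_mean {V : Type*} [Fintype V] [Nonempty V] :
    ((Fintype.card V : ℝ)⁻¹ • allOnes V V).PosSemidef := by
  have : (Fintype.card V : ℝ) ≠ 0 := by exact_mod_cast Fintype.card_ne_zero
  refine posSemidef_of_isIdempotentElem ?_ (by simp [allOnes_transpose])
  simp [allOnes_mul_allOnes, smul_smul, this]

theorem dOne_mBetter (hp : ∀ i, cosetIndex C (p i) = i) (hC₀ : Nat.card C₀ = t)
    (hF : Fintype.card F = h * t + 1) (ht : 2 ≤ t) {d : Design (settingOne p) (F × ZMod h)}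
    (hd : d.Equireplicate) (hb : d.TotallyBinary) : (dOne C p).MBetter d := by
  have hh : 1 ≤ h := Nat.one_le_iff_ne_zero.2 (NeZero.ne h)
  have hlt : h + 1 ≤ Fintype.card F := by rw [hF]; nlinarith
  have hBL : Fintype.card (ZMod h) < Fintype.card F := by rwa [ZMod.card]
  have hinj : Function.Injective p := fun i j hij => by rw [← hp i, ← hp j, hij]
  have hσ := settingOne_isUniform hinj
  have hU : Fintype.card (Fˣ × F) = Fintype.card (F × ZMod h) * t := by
    rw [card_units_prod, Fintype.card_prod, ZMod.card, hF, Nat.add_sub_cancel, mul_assoc]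
  have hV : Fintype.card (F × ZMod h) = Fintype.card (ZMod h) * Fintype.card F := by
    rw [Fintype.card_prod, mul_comm]
  have hL : Fintype.card F = Fintype.card (ZMod h) * t + 1 := by rwa [ZMod.card]
  have hrep := hd.hasReplication hU
  have hrep' := hC₀ ▸ dOne_hasReplication (C := C) (p := p)
  have hb' := dOne_totallyBinary hp
  have ht0 : t ≠ 0 := by omega
  have hsR : (h : ℝ) + 1 ≤ Fintype.card F := by exact_mod_cast hlt
  have hsh : (0 : ℝ) < (Fintype.card F : ℝ) - h := by linarith
  have hm₁ : ((Fintype.card F - 1 : ℕ) : ℝ) = (Fintype.card F : ℝ) - 1 := by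
    rw [Nat.cast_sub (by omega), Nat.cast_one]
  have hm₂ : (((Fintype.card F - 1) * (h - 1) : ℕ) : ℝ) =
      ((Fintype.card F : ℝ) - 1) * ((Fintype.card (ZMod h) : ℝ) - 1) := by
    rw [Nat.cast_mul, hm₁, Nat.cast_sub hh, Nat.cast_one, ZMod.card]
  have hc := (dOne C p).component_posSemidef (hσ.sumProj_mul_sumProj hBL) Setting.sumProj_transpose
  have hJt : ((Fintype.card (F × ZMod h) : ℝ)⁻¹ •
      allOnes (F × ZMod h) (F × ZMod h)).trace = 1 := by
    rw [Matrix.trace_smul, smul_eq_mul]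
    have : (Fintype.card (F × ZMod h) : ℝ) ≠ 0 := by exact_mod_cast Fintype.card_ne_zero
    simp only [Matrix.trace, allOnes, Matrix.diag_apply, Matrix.of_apply, Finset.sum_const,
      Finset.card_univ, nsmul_one]
    exact inv_mul_cancel₀ this
  refine weaklyMajorizedFromAbove_of_decomposition d.cMatrix_isHermitian
    (dOne C p).cMatrix_isHermitian (c := t) (ε := ((Fintype.card F : ℝ) - h)⁻¹)
    (m₁ := Fintype.card F - 1) (m₂ := (Fintype.card F - 1) * (h - 1))
    (by exact_mod_cast (by omega : 1 ≤ t)) (inv_nonneg.2 hsh.le)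
    (inv_le_one_of_one_le₀ (by linarith))
    (hrep.cMatrix_eq hσ hBL card_units_prod)
    (d.component_posSemidef Setting.meanProj_mul_meanProj Setting.meanProj_transpose)
    (d.component_posSemidef (hσ.sumProj_mul_sumProj hBL) Setting.sumProj_transpose)
    (d.component_posSemidef hσ.contrastProj_mul_contrastProj Setting.contrastProj_transpose)
    (d.component_rank_le Setting.meanProj_mul_meanProj (by rw [Setting.trace_meanProj]; simp))
    (d.component_rank_le (hσ.sumProj_mul_sumProj hBL) (by rw [hσ.trace_sumProj hBL, hm₁]))
    (d.component_rank_le hσ.contrastProj_mul_contrastProj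
      (by rw [hσ.trace_contrastProj, hm₂]))
    ?_ ?_ ?_ (dOne_cMatrix_eq hp hC₀ hF hlt ht0) posSemidef_mean (hc.smul hsh.le)
    ((dOne C p).component_posSemidef hσ.contrastProj_mul_contrastProj
      Setting.contrastProj_transpose)
    (dOne_one_sub_posSemidef hp hC₀ hF hlt) hJt ?_ ?_
  · rw [hrep.component_meanProj hU ht0, Matrix.trace_smul, hJt, smul_eq_mul, mul_one]
  · rw [hrep.trace_component_sumProj hb hL hV, ZMod.card, hm₁]
  · rw [hrep.trace_component_contrastProj hb hL hV, hm₂]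
  · rw [Matrix.trace_smul, hrep'.trace_component_sumProj hb' hL hV, ZMod.card, hm₁, smul_eq_mul,
      mul_inv_cancel_left₀ hsh.ne']
  · rw [hrep'.trace_component_contrastProj hb' hL hV, hm₂]

/-- A matrix `c - (c E₀ + ε E₁ + E₂)` which kills the constants has no further kernel, if `E₀` is
the projection onto the constants, `E₀ + E₁ + E₂ ≤ 1`, `ε ≤ 1` and `1 < c`. -/
theorem rank_add_one_eq_card {V : Type*} [Fintype V] [DecidableEq V] [Nonempty V]
    {A E₁ E₂ : Matrix V V ℝ} {c ε : ℝ} (hc : 1 < c) (hε1 : ε ≤ 1)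
    (hA : A = c • 1 - (c • ((Fintype.card V : ℝ)⁻¹ • allOnes V V) + ε • E₁ + E₂))
    (hE₁ : E₁.PosSemidef)
    (hE : (1 - ((Fintype.card V : ℝ)⁻¹ • allOnes V V + E₁ + E₂)).PosSemidef)
    (hker : A * allOnes V Unit = 0) : A.rank + 1 = Fintype.card V := by
  apply le_antisymm
  · have hpos : (allOnes V Unit).rank ≠ 0 := fun h0 => by
      have h1 := LinearMap.range_eq_bot.1 (Submodule.finrank_eq_zero.1 h0)
      have h2 := congrFun (LinearMap.congr_fun h1 fun _ => 1) (Classical.arbitrary V)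
      simp [allOnes, Matrix.mulVec, dotProduct] at h2
    have := Matrix.rank_add_rank_le_card_of_mul_eq_zero hker
    omega
  -- Adding the rank-one matrix `c E₀` gives at least `c - 1 > 0`, hence an invertible matrix; so
  -- `A` has corank at most one.
  · have hpd : (A + c • ((Fintype.card V : ℝ)⁻¹ • allOnes V V)).PosDef := by
      have : A + c • ((Fintype.card V : ℝ)⁻¹ • allOnes V V) = (c - 1) • 1 +
          ((1 - ((Fintype.card V : ℝ)⁻¹ • allOnes V V + E₁ + E₂)) + (1 - ε) • E₁ +
            (Fintype.card V : ℝ)⁻¹ • allOnes V V) := by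
        rw [hA]; module
      rw [this]
      exact (PosDef.one.smul (by linarith)).add_posSemidef
        ((hE.add (hE₁.smul (by linarith))).add posSemidef_mean)
    rw [← Matrix.rank_of_isUnit _ hpd.isUnit]
    refine (rank_add_le _ _).trans (Nat.add_le_add_left ?_ _)
    have : c • ((Fintype.card V : ℝ)⁻¹ • allOnes V V) =
        vecMulVec (fun _ => c * (Fintype.card V : ℝ)⁻¹) (fun _ => 1) := by
      ext i j; simp [allOnes, vecMulVec_apply]
    rw [this]
    exact rank_vecMulVec_le _ _

theorem dOne_connected (hp : ∀ i, cosetIndex C (p i) = i) (hC₀ : Nat.card C₀ = t)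
    (hF : Fintype.card F = h * t + 1) (ht : 2 ≤ t) : (dOne C p).Connected := by
  have hh : 1 ≤ h := Nat.one_le_iff_ne_zero.2 (NeZero.ne h)
  have hlt : h + 1 ≤ Fintype.card F := by rw [hF]; nlinarith
  have hBL : Fintype.card (ZMod h) < Fintype.card F := by rwa [ZMod.card]
  have hinj : Function.Injective p := fun i j hij => by rw [← hp i, ← hp j, hij]
  have hσ := settingOne_isUniform hinj
  have hsR : (h : ℝ) + 1 ≤ Fintype.card F := by exact_mod_cast hlt
  have hsh : (0 : ℝ) < (Fintype.card F : ℝ) - h := by linarith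
  refine rank_add_one_eq_card (c := t) (ε := ((Fintype.card F : ℝ) - h)⁻¹)
    (by exact_mod_cast (by omega : 1 < t))
    (inv_le_one_of_one_le₀ (by linarith)) (dOne_cMatrix_eq hp hC₀ hF hlt (by omega))
    (((dOne C p).component_posSemidef (hσ.sumProj_mul_sumProj hBL)
      Setting.sumProj_transpose).smul hsh.le)
    (dOne_one_sub_posSemidef hp hC₀ hF hlt) ?_
  -- `X_V 1` is the all-ones vector of the units, which also equals `X_0 1` and is thus fixed by the
  -- nuisance projection.
  have h1 : (dOne C p).treatmentMatrix * allOnes (F × ZMod h) Unit =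
      (settingOne p).blockMatrix 0 * allOnes F Unit := by
    rw [Design.treatmentMatrix_mul_allOnes, Setting.blockMatrix_mul_allOnes]
  rw [Design.cMatrix, hσ.colProj_nuisanceMatrix hBL card_units_prod, Matrix.mul_assoc, h1,
    Matrix.mul_assoc, ← Matrix.mul_assoc (1 - _), Matrix.sub_mul,
    hσ.proj_mul_blockMatrix hBL card_units_prod]
  simp

end DOne

end MultiwayDesign

theorem theorem5p1 {F : Type*} [Field F] [Fintype F] [DecidableEq F]
    (h t : ℕ) [NeZero h] (ht : 2 ≤ t) (hF : Fintype.card F = h * t + 1)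
    (C₀ : Subgroup Fˣ) (hC₀ : Nat.card C₀ = t)
    (C : Multiplicative (ZMod h) ≃* Fˣ ⧸ C₀)
    (p : ZMod h → Fˣ)
    (hp : ∀ i : ZMod h, (p i : Fˣ ⧸ C₀) = C (Multiplicative.ofAdd i)) :
    (MultiwayDesign.settingOne p).IsTypeOne ∧
      (MultiwayDesign.dOne C p).Connected ∧
      MultiwayDesign.Design.MOptimal
        (MultiwayDesign.Design.equireplicateTotallyBinary (MultiwayDesign.settingOne p))
        (MultiwayDesign.dOne C p) := by
  have hp' : ∀ i, MultiwayDesign.cosetIndex C (p i) = i := fun i =>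
    (MultiwayDesign.cosetIndex_eq_iff C (p i) i).2 (hp i)
  have hinj : Function.Injective p := fun i j hij => by rw [← hp' i, ← hp' j, hij]
  exact ⟨⟨MultiwayDesign.card_units_prod, (MultiwayDesign.settingOne_isUniform hinj).1⟩,
    MultiwayDesign.dOne_connected hp' hC₀ hF ht,
    ⟨⟨_, MultiwayDesign.dOne_hasReplication⟩, MultiwayDesign.dOne_totallyBinary hp'⟩,
    fun _ hd => MultiwayDesign.dOne_mBetter hp' hC₀ hF ht hd.1 hd.2⟩
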